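/- Let $M$ be a finite monoid. The principal two-sided ideal of $m\in M$ is $MmM$. For a principal ideal $X$ put $M_X=\{m\in M: X\subseteq MmM\}$ and $X^{\ngeq}=M\setminus M_X$; $X$ is \emph{primary} if $M_X$ is a submonoid of $M$. Let $\Lambda(M)$ be the set of primary ideals ordered by inclusion. Idempotents $e,f$ are \emph{conjugate} if $MeM=MfM$, and $e<f$ means $ef=e=fe$, $e\ne f$. $M$ is \emph{rectangular} if each conjugacy class of idempotents is a subsemigroup. The maximal subgroup $G_e$ at an idempotent $e$ is the group of units of the monoid $eMe$. The quiver $Q(A)$ of a finite-dimensional algebra $A$ split over a field $k$ (that is, $A/\mathrm{rad}(A)$ is a product of matrix algebras over $k$) has as vertices the isomorphism classes of simple left $A$-modules, with $\dim_k\mathrm{Ext}^1_A(S,T)$ arrows from $S$ to $T$. \textbf{Theorem.} Let $M$ be a finite rectangular monoid all of whose maximal subgroups are trivial, and let $k$ be any field. Then $kM$ splits over $k$, and $Q(kM)$ has vertex set $\Lambda(M)$: the map sending $X\in\Lambda(M)$ to the class of the one-dimensional module $S_X$, on which $m\in M$ acts as $1$ if $m\in M_X$ and as $0$ otherwise, is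 a bijection onto the set of isomorphism classes of simple $kM$-modules. Every $X\in\Lambda(M)$ is generated by an idempotent; if $X<Y$ and $f$ is an idempotent generating $Y$, then there is an idempotent $e<f$ generating $X$. For $X,Y\in\Lambda(M)$ the number of arrows from $X$ to $Y$ is $\dim_k V_{X,Y}$, where $V_{X,Y}$ is the following space, for any choice of idempotents $e=e_X$, $f=e_Y$ with $MeM=X$, $MfM=Y$ and, respectively, $e=f$ if $X=Y$, $e<f$ if $X<Y$, $f<e$ if $Y<X$. Put $Y^{\ngeq}X^{\ngeq}=\{mn: m\in Y^{\ngeq}, n\in X^{\ngeq}\}$. (1) If $X,Y$ are incomparable, $V_{X,Y}$ is the quotient of $k[fMe]$ by the span of $fMe\cap Y^{\ngeq}X^{\ngeq}$ and of all $fmne+fmfene-fmfne-fmene$ with $m,n\in M$. (2) If $X=Y$, let $I_X=eMe\setminus G_e$ and let $\sim$ be the least equivalence relation on $I_X$ such that $emne\sim emene$ whenever $mn\in X^{\ngeq}$, and $z\sim z'$ for all $z,z'\in I_X\cap X^{\ngeq}X^{\ngeq}$. Then $V_{X,X}$ is the quotient of $kI_X$ by the span of $I_X\cap X^{\ngeq}X^{\ngeq}$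 and of all $a-b$ with $a\sim b$. (3) If $X<Y$, let $\sim$ be the least equivalence relation on $fMe$ such that $fmne\sim fmfne$ for all $m,n\in M$; $fmne\sim fmene$ for all $m\in Y^{\ngeq}$, $n\in M$; and $z\sim z'$ for all $z,z'\in fMe\cap Y^{\ngeq}X^{\ngeq}$. Let $W_{X,Y}$ be the quotient of $k[fMe]$ by the span of $fMe\cap Y^{\ngeq}X^{\ngeq}$ and of all $a-b$ with $a\sim b$. Then $V_{X,Y}$ is the kernel of the linear map $W_{X,Y}\to kG_e$ induced by $a\mapsto eae$ if $a\in M_X$ and $a\mapsto 0$ otherwise. (4) If $Y<X$, $V_{X,Y}$ is the space of (3) for the opposite monoid $M^{op}$ with the roles of $X$ and $Y$ (and of $e$ and $f$) exchanged. -/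

import Mathlib

namespace RectMonoid

open CategoryTheory

universe u v w

/-! ### Finite-dimensional algebras: splitting and the Gabriel quiver -/

section Quiver

/-- The `k`-algebra `A` splits over `k`: `A / rad A` is a finite product of matrix algebras
over `k`. -/
def IsSplit (k : Type v) (A : Type w) [Field k] [Ring A] [Algebra k A] : Prop :=
  ∃ (n : ℕ) (d : Fin n → ℕ),
    Nonempty ((A ⧸ Ring.jacobson A) ≃ₐ[k] (∀ i : Fin n, Matrix (Fin (d i)) (Fin (d i)) k))

/-- Simple left `A`-modules up to isomorphism of modules. -/
def simpleSetoid (A : Type w) [Ring A] :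
    Setoid {S : ModuleCat.{v} A // IsSimpleModule A S} where
  r S T := Nonempty (S.1 ≅ T.1)
  iseqv :=
    { refl := fun S => ⟨Iso.refl S.1⟩
      symm := fun ⟨i⟩ => ⟨i.symm⟩
      trans := fun ⟨i⟩ ⟨j⟩ => ⟨i.trans j⟩ }

/-- The vertex set of the quiver of `A`: the isomorphism classes of simple left `A`-modules. -/
def QuiverVertex (A : Type w) [Ring A] : Type (max w (v + 1)) :=
  Quotient (simpleSetoid.{v} A)

/-- `dim_k Ext¹_A(S, T)`. -/
noncomputable def extDim (k : Type v) (A : Type w) [Field k] [Ring A] [Algebra k A] [Small.{v} A]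
    (S T : ModuleCat.{v} A) : Cardinal.{v} :=
  Module.rank k (Abelian.Ext.{v} S T 1)

/-- Isomorphic arguments have `Ext` groups that are linearly isomorphic. -/
noncomputable def extLinearEquiv (k : Type v) (A : Type w) [Field k] [Ring A] [Algebra k A]
    [Small.{v} A] {S S' T T' : ModuleCat.{v} A} (i : S ≅ S') (j : T ≅ T') :
    Abelian.Ext.{v} S T 1 ≃ₗ[k] Abelian.Ext.{v} S' T' 1 where
  toFun x := (Abelian.Ext.mk₀ i.inv).comp (x.comp (Abelian.Ext.mk₀ j.hom) (add_zero 1)) (zero_add 1)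
  map_add' x y := by simp
  map_smul' c x := by simp
  invFun x := (Abelian.Ext.mk₀ i.hom).comp (x.comp (Abelian.Ext.mk₀ j.inv) (add_zero 1)) (zero_add 1)
  left_inv x := by
    simp
  right_inv x := by
    simp

lemma extDim_congr (k : Type v) (A : Type w) [Field k] [Ring A] [Algebra k A]
    [Small.{v} A] {S S' T T' : ModuleCat.{v} A} (i : S ≅ S') (j : T ≅ T') :
    extDim k A S T = extDim k A S' T' :=
  (extLinearEquiv k A i j).rank_eq

/-- The number of arrows `x → y` in the quiver of `A`, namely `dim_k Ext¹_A(S, T)` for simple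
modules `S`, `T` in the classes `x`, `y`. -/
noncomputable def numArrows (k : Type v) (A : Type w) [Field k] [Ring A] [Algebra k A]
    [Small.{v} A] (x y : QuiverVertex.{v} A) : Cardinal.{v} :=
  Quotient.liftOn₂ x y (fun S T => extDim k A S.1 T.1)
    (fun _ _ _ _ ⟨i⟩ ⟨j⟩ => extDim_congr k A i j)

end Quiver

/-! ### Ideals, idempotents, rectangular monoids, the support lattice -/

section Monoids

variable {M : Type u} [Monoid M]

/-- The principal two-sided ideal `MmM`. -/
def principalIdeal (m : M) : Set M := {x | ∃ a b : M, x = a * m * b}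

/-- `M_X = {m | X ⊆ MmM}`.  For a primary ideal `X`, membership `m ∈ M_X` is the relation
`σ(m) ≥ X` for the support map `σ`. -/
def aboveSet (X : Set M) : Set M := {m | X ⊆ principalIdeal m}

/-- The complement of `M_X`. -/
def notAbove (X : Set M) : Set M := (aboveSet X)ᶜ

/-- A set `X` is a primary ideal if it is a principal ideal such that `M_X` is a submonoid
(that `1 ∈ M_X` is automatic). -/
def IsPrimary (X : Set M) : Prop :=
  (∃ m : M, X = principalIdeal m) ∧
    ∀ a b : M, a ∈ aboveSet X → b ∈ aboveSet X → a * b ∈ aboveSet X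

variable (M) in
/-- The support lattice: the primary ideals of `M`, ordered by inclusion. -/
abbrev SupportLattice : Type u := {X : Set M // IsPrimary X}

/-- Two idempotents are conjugate if they generate the same two-sided ideal. -/
def Conj (e f : M) : Prop :=
  IsIdempotentElem e ∧ IsIdempotentElem f ∧ principalIdeal e = principalIdeal f

variable (M) in
/-- `M` is rectangular: every conjugacy class of idempotents is a subsemigroup. -/
def IsRectangular : Prop :=
  ∀ d e f : M, Conj d e → Conj d f → Conj d (e * f)

/-- The set `fMe`. -/
def corner (f e : M) : Set M := {x | ∃ m : M, x = f * m * e}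

/-- The element `fme` of `fMe`. -/
def toCorner (f e m : M) : corner f e := ⟨f * m * e, m, rfl⟩

/-- The maximal subgroup `G_e`, i.e. the group of units of the monoid `eMe`, for `e` idempotent. -/
def maximalSubgroup (e : M) : Set M :=
  {x | x ∈ corner e e ∧ ∃ y ∈ corner e e, x * y = e ∧ y * x = e}

variable (M) in
/-- All maximal subgroups of `M` are trivial. -/
def HasTrivialMaximalSubgroups : Prop :=
  ∀ e : M, IsIdempotentElem e → maximalSubgroup e = {e}

/-- The natural partial order on idempotents, strict version: `e < f`. -/
def IdemLT (e f : M) : Prop := e * f = e ∧ f * e = e ∧ e ≠ f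

/-- The set of products `mn` with `m` not above `MfM` and `n` not above `MeM`. -/
def nullProducts (f e : M) : Set M :=
  {z | ∃ m ∈ notAbove (principalIdeal f), ∃ n ∈ notAbove (principalIdeal e), z = m * n}

end Monoids

/-! ### The simple module attached to a primary ideal -/

section Simple

variable {M : Type u} [Monoid M]

lemma one_mem_aboveSet (X : Set M) : (1 : M) ∈ aboveSet X :=
  fun x _ => ⟨x, 1, by simp⟩

lemma mem_aboveSet_left {X : Set M} {a b : M} (h : a * b ∈ aboveSet X) : a ∈ aboveSet X := by
  intro x hx
  obtain ⟨c, d, rfl⟩ := h hx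
  exact ⟨c, b * d, by simp only [mul_assoc]⟩

lemma mem_aboveSet_right {X : Set M} {a b : M} (h : a * b ∈ aboveSet X) : b ∈ aboveSet X := by
  intro x hx
  obtain ⟨c, d, rfl⟩ := h hx
  exact ⟨c * a, d, by simp only [mul_assoc]⟩

open Classical in
/-- The homomorphism `M → {0, 1} ⊆ k` sending `M_X` to `1` and its complement to `0`. -/
noncomputable def supportChar (k : Type v) [Field k] (X : SupportLattice M) : M →* k where
  toFun m := if m ∈ aboveSet X.1 then 1 else 0
  map_one' := if_pos (one_mem_aboveSet X.1)
  map_mul' a b := by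
    by_cases ha : a ∈ aboveSet X.1
    · by_cases hb : b ∈ aboveSet X.1
      · simp [ha, hb, X.2.2 a b ha hb]
      · have : a * b ∉ aboveSet X.1 := fun h => hb (mem_aboveSet_right h)
        simp [hb, this]
    · have : a * b ∉ aboveSet X.1 := fun h => ha (mem_aboveSet_left h)
      simp [ha, this]

/-- The linear extension `kM → k` of `supportChar`. -/
noncomputable def supportAlgHom (k : Type v) [Field k] (X : SupportLattice M) :
    MonoidAlgebra k M →ₐ[k] k :=
  MonoidAlgebra.lift k k M (supportChar k X)

/-- The one-dimensional `kM`-module on which `m` acts as `1` if `m ∈ M_X` and as `0` otherwise. -/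
noncomputable def supportModule (k : Type v) [Field k] (X : SupportLattice M) :
    ModuleCat.{v} (MonoidAlgebra k M) :=
  (ModuleCat.restrictScalars.{v} (supportAlgHom k X).toRingHom).obj (ModuleCat.of k k)

lemma isSimpleModule_supportModule (k : Type v) [Field k] (X : SupportLattice M) :
    IsSimpleModule (MonoidAlgebra k M) (supportModule k X) := by
  have : RingHomSurjective (supportAlgHom k X).toRingHom :=
    ⟨fun c => ⟨algebraMap k _ c, by
      exact (supportAlgHom k X).commutes c⟩⟩
  have hs : IsSimpleModule k k := inferInstance
  let l : supportModule k X →ₛₗ[(supportAlgHom k X).toRingHom] k :=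
    { toFun := fun x => x, map_add' := fun _ _ => rfl, map_smul' := fun _ _ => rfl }
  exact (LinearMap.isSimpleModule_iff_of_bijective l Function.bijective_id).2 hs

instance small_monoidAlgebra (k : Type v) [Field k] (M : Type u) [Finite M] :
    Small.{v} (MonoidAlgebra k M) := by
  have : Function.Injective (fun (x : MonoidAlgebra k M) (m : M) => x.coeff m) := by
    intro x y h
    ext m
    exact congrFun h m
  exact small_of_injective this

/-- The vertex of the quiver of `kM` given by the class of `supportModule k X`. -/
noncomputable def supportVertex (k : Type v) [Field k] (X : SupportLattice M) :
    QuiverVertex.{v} (MonoidAlgebra k M) :=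
  Quotient.mk (simpleSetoid.{v} (MonoidAlgebra k M))
    ⟨supportModule k X, isSimpleModule_supportModule k X⟩

end Simple

/-! ### The spaces `V_{X,Y}`

Throughout, `e` and `f` are idempotent generators of `X` and `Y` respectively. -/

section Spaces

variable {M : Type u} [Monoid M] (k : Type v) [Field k]

/-- `X`, `Y` incomparable: the subspace of `k[fMe]` spanned by the elements of `fMe` that are
products of an element not above `Y` and an element not above `X`, and by the elements
`fmne + fmfene - fmfne - fmene`. -/
noncomputable def relIncomparable (e f : M) : Submodule k (corner f e →₀ k) :=
  Submodule.span k
    ({v | ∃ z : corner f e, (z : M) ∈ nullProducts f e ∧ v = Finsupp.single z 1} ∪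
     {v | ∃ m n : M, v =
        Finsupp.single (toCorner f e (m * n)) 1
        + Finsupp.single (toCorner f e (m * f * e * n)) 1
        - Finsupp.single (toCorner f e (m * f * n)) 1
        - Finsupp.single (toCorner f e (m * e * n)) 1})

/-- `V_{X,Y}` for incomparable `X`, `Y`. -/
abbrev VIncomparable (e f : M) : Type (max u v) :=
  (corner f e →₀ k) ⧸ relIncomparable k e f

/-- `I_X = eMe \ G_e`. -/
def nonUnits (e : M) : Set M := corner e e \ maximalSubgroup e

/-- The generating pairs of the equivalence relation on `I_X` in the case `X = Y`. -/
def simEqBase (e : M) (x y : nonUnits e) : Prop :=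
  (∃ m n : M, m * n ∈ notAbove (principalIdeal e) ∧
      (x : M) = e * (m * n) * e ∧ (y : M) = e * (m * e * n) * e) ∨
  ((x : M) ∈ nullProducts e e ∧ (y : M) ∈ nullProducts e e)

/-- `X = Y`: the subspace `W_X` of `k[I_X]`. -/
noncomputable def relEq (e : M) : Submodule k (nonUnits e →₀ k) :=
  Submodule.span k
    ({v | ∃ z : nonUnits e, (z : M) ∈ nullProducts e e ∧ v = Finsupp.single z 1} ∪
     {v | ∃ x y : nonUnits e, Relation.EqvGen (simEqBase e) x y ∧
        v = Finsupp.single x 1 - Finsupp.single y 1})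

/-- `V_{X,X}`. -/
abbrev VEq (e : M) : Type (max u v) :=
  (nonUnits e →₀ k) ⧸ relEq k e

/-- The generating pairs of the equivalence relation on `fMe` in the case `X < Y`, `e < f`. -/
def simLTBase (e f : M) (x y : corner f e) : Prop :=
  (∃ m n : M, x = toCorner f e (m * n) ∧ y = toCorner f e (m * f * n)) ∨
  (∃ m ∈ notAbove (principalIdeal f), ∃ n : M,
      x = toCorner f e (m * n) ∧ y = toCorner f e (m * e * n)) ∨
  ((x : M) ∈ nullProducts f e ∧ (y : M) ∈ nullProducts f e)

/-- `X < Y`: the subspace `Z_{X,Y}` of `k[fMe]`. -/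
noncomputable def relLT (e f : M) : Submodule k (corner f e →₀ k) :=
  Submodule.span k
    ({v | ∃ z : corner f e, (z : M) ∈ nullProducts f e ∧ v = Finsupp.single z 1} ∪
     {v | ∃ x y : corner f e, Relation.EqvGen (simLTBase e f) x y ∧
        v = Finsupp.single x 1 - Finsupp.single y 1})

open Classical in
/-- The linear map `ρ_X` on `k[fMe]` that sends `a` to `eae ∈ G_e` if `a ∈ M_X` and to `0`
otherwise, with `kG_e` viewed inside `k[M]`. -/
noncomputable def rhoLT (e f : M) : (corner f e →₀ k) →ₗ[k] (M →₀ k) :=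
  Finsupp.linearCombination k (fun a : corner f e =>
    if (a : M) ∈ aboveSet (principalIdeal e) then Finsupp.single (e * (a : M) * e) (1 : k) else 0)

/-- `V_{X,Y}` for `X < Y` and `e < f`, as a subspace of `W_{X,Y} = k[fMe] / Z_{X,Y}`: the kernel
of the map induced on `W_{X,Y}` by `ρ_X`, written as the image of `ker ρ_X` in `W_{X,Y}`
(see `VLT_eq_ker`). -/
noncomputable def VLT (e f : M) : Submodule k ((corner f e →₀ k) ⧸ relLT k e f) :=
  (LinearMap.ker (rhoLT k e f)).map (relLT k e f).mkQ

lemma VLT_eq_ker (e f : M) (h : relLT k e f ≤ LinearMap.ker (rhoLT k e f)) :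
    VLT k e f = LinearMap.ker ((relLT k e f).liftQ (rhoLT k e f) h) :=
  (Submodule.ker_liftQ _ _ h).symm

/-- `V_{X,Y}` for `Y < X` and `f < e`: the previous construction for the opposite monoid with the
roles of `X` and `Y` exchanged. -/
noncomputable def VGT (e f : M) :
    Submodule k ((corner (MulOpposite.op e) (MulOpposite.op f) →₀ k) ⧸
      relLT k (MulOpposite.op f) (MulOpposite.op e)) :=
  VLT k (MulOpposite.op f) (MulOpposite.op e)

end Spaces

end RectMonoid

namespace RectMonoid

/-! ### Regular ideals of rectangular monoids with trivial maximal subgroups -/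

section Structure

variable {M : Type*} [Monoid M]

/-! Rectangularity makes the elements above an idempotent `e` closed under multiplication
(`mul_mem_aboveSet`), so `MeM` is primary. Stability of finite monoids puts `eme` in `G_e` whenever
`m` is above `e`, so triviality of `G_e` yields `eme = e` (`idem_mul_mul_idem`). Applied to an
idempotent whose ideal is minimal among those of elements not annihilating a simple module, this
produces an eigenvector for some character `χ_X` (`exists_eigenvector`). Hence all simples are the
`S_X`, and `kM` modulo its radical is a product of copies of `k`.

For the arrows, write `φ = χ_Y` and `ψ = χ_X`. The presentation of `S_X` as `kM` modulo the kernel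
of `χ_X` identifies `Ext¹(S_X, S_Y)` with the functions `d` satisfying `d(mn) = φ(m)d(n) +
d(m)ψ(n)`, modulo the multiples of `φ - ψ` (`derivationToExt_surjective`, `ker_derivationToExt`). By
`derivation_corner`, such a `d` is determined by its restriction to `fMe` together with `d(e)` and
`d(f)`. The restrictions that occur are exactly the functions killing the stated relations, that is,
the dual of the quotient of `k[fMe]` (of `kI_X` if `X = Y`). What remains is to count the free
scalars `d(e)`, `d(f)` and the inner derivations: the latter form a line if `X ≠ Y` and vanish if `X
= Y`. -/

lemma exists_pow_isIdempotentElem [Finite M] (a : M) :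
    ∃ n : ℕ, n ≠ 0 ∧ IsIdempotentElem (a ^ n) := by
  obtain ⟨i, j, hij, h⟩ := Finite.exists_ne_map_eq_of_infinite (fun n : ℕ => a ^ n)
  wlog hlt : i < j generalizing i j
  · exact this j i hij.symm h.symm (by omega)
  obtain ⟨p, rfl⟩ := Nat.exists_eq_add_of_lt hlt
  have step : ∀ t n : ℕ, i ≤ n → a ^ (n + t * (p + 1)) = a ^ n := by
    intro t
    induction t with
    | zero => simp
    | succ t ih =>
      intro n hn
      obtain ⟨c, rfl⟩ := Nat.exists_eq_add_of_le hn
      rw [show i + c + (t + 1) * (p + 1) = (i + p + 1) + (c + t * (p + 1)) by ring, pow_add]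
      rw [← h, ← pow_add, ← add_assoc]
      exact ih _ hn
  -- Powers have period `p + 1` from exponent `i` on; this exponent is a nonzero multiple of the
  -- period and at least `i`, so doubling it changes nothing.
  refine ⟨(i + 1) * (p + 1), by positivity, ?_⟩
  rw [IsIdempotentElem, ← pow_add]
  exact step (i + 1) _ (by nlinarith)

lemma mem_principalIdeal_self (m : M) : m ∈ principalIdeal m := ⟨1, 1, by simp⟩

lemma principalIdeal_subset_iff {x y : M} :
    principalIdeal x ⊆ principalIdeal y ↔ ∃ a b, x = a * y * b := by
  constructor
  · intro h
    exact h (mem_principalIdeal_self x)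
  · rintro ⟨a, b, rfl⟩ _ ⟨c, d, rfl⟩
    exact ⟨c * a, b * d, by simp only [mul_assoc]⟩

lemma mem_aboveSet_principalIdeal {x m : M} :
    m ∈ aboveSet (principalIdeal x) ↔ ∃ a b, x = a * m * b :=
  principalIdeal_subset_iff

lemma self_mem_aboveSet (e : M) : e ∈ aboveSet (principalIdeal e) :=
  mem_aboveSet_principalIdeal.2 ⟨1, 1, by simp⟩

lemma principalIdeal_mul_subset_right (a b : M) : principalIdeal (a * b) ⊆ principalIdeal b :=
  principalIdeal_subset_iff.2 ⟨a, 1, by simp⟩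

/-- In a finite monoid, one-sided inverses in `eMe` are two-sided. -/
lemma mul_eq_idem_symm [Finite M] {e a z : M} (h : a * z = e) (hz : e * z = z) (ha : a * e = a) :
    z * a = e := by
  obtain ⟨n, hn, hid⟩ := exists_pow_isIdempotentElem z
  obtain ⟨n, rfl⟩ := Nat.exists_eq_succ_of_ne_zero hn
  have hzn : e * z ^ (n + 1) = z ^ (n + 1) := by rw [pow_succ', ← mul_assoc, hz]
  have hpow : ∀ j : ℕ, a ^ (j + 1) * z ^ (j + 1) = e := by
    intro j
    induction j with
    | zero => simpa using h
    | succ j ih =>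
      calc a ^ (j + 1 + 1) * z ^ (j + 1 + 1) = a ^ (j + 1) * ((a * z) * z) * z ^ j := by
            rw [pow_succ a, pow_succ' z (j + 1), pow_succ' z j]; simp only [mul_assoc]
        _ = a ^ (j + 1) * z ^ (j + 1) := by rw [h, hz, mul_assoc, ← pow_succ']
        _ = e := ih
  -- Cancelling one factor of the idempotent `z ^ (n + 1)` by `a ^ (n + 1)` forces it to be `e`.
  have hze : z ^ (n + 1) = e := by
    calc z ^ (n + 1) = a ^ (n + 1) * (z ^ (n + 1) * z ^ (n + 1)) := by
          rw [← mul_assoc, hpow, hzn]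
      _ = e := by rw [hid, hpow]
  calc z * a = z * (a * z ^ (n + 1)) := by rw [hze, ha]
    _ = z * (a * z) * z ^ n := by rw [pow_succ']; simp only [mul_assoc]
    _ = z ^ (n + 1) * z ^ (n + 1) := by
      nth_rw 1 [h, ← hze]
      rw [mul_assoc, ← pow_add, ← pow_succ', ← pow_add]
      congr 1
    _ = e := by rw [hid, hze]

/-- Stability: an element of `eMe` generating the same ideal as `e` is a unit of `eMe`. -/
lemma mem_maximalSubgroup_of_mem_aboveSet [Finite M] {e x : M} (he : IsIdempotentElem e)
    (hx : x ∈ corner e e) (hxe : x ∈ aboveSet (principalIdeal e)) : x ∈ maximalSubgroup e := by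
  obtain ⟨m, hm⟩ := hx
  have hex : e * x = x := by rw [hm, ← mul_assoc, ← mul_assoc, he]
  have hxe' : x * e = x := by rw [hm, mul_assoc, he]
  obtain ⟨a, b, hab⟩ := mem_aboveSet_principalIdeal.1 hxe
  have hee : e * e = e := he
  -- From `e = axb` one gets `(eae)(x(ebe)) = e`; swapping the two factors turns this into a right
  -- inverse of `x`, and a second swap makes it two-sided.
  have h1 : x * (e * b * e * (e * a * e)) = e := by
    rw [← mul_assoc]
    refine mul_eq_idem_symm (a := e * a * e) ?_ ?_ ?_
    · calc e * a * e * (x * (e * b * e)) = e * (a * ((e * x) * e) * b) * e := by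
            simp only [mul_assoc]
        _ = e := by rw [hex, hxe', ← hab, hee, hee]
    · rw [← mul_assoc, hex]
    · rw [mul_assoc, hee]
  refine ⟨⟨m, hm⟩, _, ⟨b * e * (e * a), by simp only [mul_assoc]⟩, h1,
    mul_eq_idem_symm h1 ?_ hxe'⟩
  simp only [← mul_assoc, hee]

/-! ### Elements above an idempotent, and idempotent generators of primary ideals. -/

section Rectangular

variable [Finite M] (hrect : IsRectangular M) (htriv : HasTrivialMaximalSubgroups M)
include hrect

omit [Finite M] hrect in
/-- An element above an idempotent `e` has a left multiple which is an idempotent conjugate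
to `e`. -/
lemma exists_conj_mul_left {e m : M} (he : IsIdempotentElem e)
    (hm : m ∈ aboveSet (principalIdeal e)) : ∃ c, Conj e (c * m) := by
  obtain ⟨a, b, hab⟩ := mem_aboveSet_principalIdeal.1 hm
  have hee : e * e = e := he
  -- With `e = amb`, the element `b·e·am` is `e` transported along `b` and `am`: squaring it creates
  -- the inner factor `amb = e`.
  refine ⟨b * e * a, he, ?_, (principalIdeal_subset_iff.2 ⟨a * m, b, ?_⟩).antisymm
    (principalIdeal_subset_iff.2 ⟨b, a * m, ?_⟩)⟩
  · calc b * e * a * m * (b * e * a * m) = b * e * (a * m * b) * e * (a * m) := by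
          simp only [mul_assoc]
      _ = b * e * a * m := by rw [← hab, mul_assoc b e e, hee, mul_assoc b e e, hee, ← mul_assoc]
  · calc e = (a * m * b) * e * (a * m * b) := by rw [← hab, hee, hee]
      _ = a * m * (b * e * a * m) * b := by simp only [mul_assoc]
  · simp only [mul_assoc]

omit [Finite M] hrect in
lemma exists_conj_mul_right {e m : M} (he : IsIdempotentElem e)
    (hm : m ∈ aboveSet (principalIdeal e)) : ∃ c, Conj e (m * c) := by
  obtain ⟨a, b, hab⟩ := mem_aboveSet_principalIdeal.1 hm
  have hee : e * e = e := he
  refine ⟨b * e * a, he, ?_, (principalIdeal_subset_iff.2 ⟨a, m * b, ?_⟩).antisymm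
    (principalIdeal_subset_iff.2 ⟨m * b, a, ?_⟩)⟩
  · calc m * (b * e * a) * (m * (b * e * a)) = m * b * e * (a * m * b) * e * a := by
          simp only [mul_assoc]
      _ = m * (b * e * a) := by
        rw [← hab, mul_assoc _ e e, hee, mul_assoc _ e e, hee]
        simp only [mul_assoc]
  · calc e = (a * m * b) * e * (a * m * b) := by rw [← hab, hee, hee]
      _ = a * (m * (b * e * a)) * (m * b) := by simp only [mul_assoc]
  · simp only [mul_assoc]

omit [Finite M] in
-- Rectangularity enters here: `ca` and `bd` are conjugate to `e` for suitable `c`, `d`, so their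
-- product is too, and it factors through `ab`.
lemma mul_mem_aboveSet {e a b : M} (he : IsIdempotentElem e)
    (ha : a ∈ aboveSet (principalIdeal e)) (hb : b ∈ aboveSet (principalIdeal e)) :
    a * b ∈ aboveSet (principalIdeal e) := by
  obtain ⟨c, hc⟩ := exists_conj_mul_left he ha
  obtain ⟨d, hd⟩ := exists_conj_mul_right he hb
  have h := (hrect _ _ _ hc hd).2.2
  obtain ⟨u, v, h⟩ := principalIdeal_subset_iff.1 h.le
  exact mem_aboveSet_principalIdeal.2 ⟨u * c, d * v, by rw [h]; simp only [mul_assoc]⟩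

omit [Finite M] in
lemma isPrimary_principalIdeal {e : M} (he : IsIdempotentElem e) :
    IsPrimary (principalIdeal e) :=
  ⟨⟨e, rfl⟩, fun _ _ ha hb => mul_mem_aboveSet hrect he ha hb⟩

include htriv in
/-- `eme = e` for every `m` above the idempotent `e`. -/
lemma idem_mul_mul_idem {e m : M} (he : IsIdempotentElem e)
    (hm : m ∈ aboveSet (principalIdeal e)) : e * m * e = e := by
  have h1 := mul_mem_aboveSet hrect he (mul_mem_aboveSet hrect he (self_mem_aboveSet e) hm)
    (self_mem_aboveSet e)
  have h2 := mem_maximalSubgroup_of_mem_aboveSet he ⟨m, rfl⟩ h1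
  rw [htriv e he] at h2
  exact h2

omit hrect in
-- `M_X` is a submonoid containing the generator `m`, hence also the idempotent power of `m`; that
-- power therefore still generates `X`.
lemma exists_idem_generator {X : Set M} (hX : IsPrimary X) :
    ∃ e : M, IsIdempotentElem e ∧ principalIdeal e = X := by
  obtain ⟨⟨m, rfl⟩, hmul⟩ := hX
  obtain ⟨n, hn, he⟩ := exists_pow_isIdempotentElem m
  have hpow : ∀ j : ℕ, m ^ j ∈ aboveSet (principalIdeal m) := by
    intro j
    induction j with
    | zero => rw [pow_zero]; exact one_mem_aboveSet _
    | succ j ih => rw [pow_succ]; exact hmul _ _ ih (self_mem_aboveSet m)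
  refine ⟨m ^ n, he, Set.Subset.antisymm ?_ (hpow n)⟩
  obtain ⟨j, rfl⟩ := Nat.exists_eq_succ_of_ne_zero hn
  rw [pow_succ]
  exact principalIdeal_mul_subset_right _ _

omit [Finite M] hrect in
-- If `e = ufv`, transporting `e` along `fv` and `uf` moves it into `fMf` without changing its
-- ideal.
lemma exists_idem_lt {e f : M} (he : IsIdempotentElem e) (hf : IsIdempotentElem f)
    (hlt : principalIdeal e ⊂ principalIdeal f) :
    ∃ g : M, IsIdempotentElem g ∧ principalIdeal g = principalIdeal e ∧ IdemLT g f := by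
  obtain ⟨u, v, h⟩ := principalIdeal_subset_iff.1 hlt.1
  have hee : e * e = e := he
  have hff : f * f = f := hf
  have key : principalIdeal (f * v * e * u * f) = principalIdeal e := by
    refine (principalIdeal_subset_iff.2 ⟨f * v, u * f, by simp only [mul_assoc]⟩).antisymm
      (principalIdeal_subset_iff.2 ⟨u, v, ?_⟩)
    calc e = (u * f * v) * e * (u * f * v) := by rw [← h, hee, hee]
      _ = u * (f * v * e * u * f) * v := by simp only [mul_assoc]
  refine ⟨f * v * e * u * f, ?_, key, ?_, ?_, ?_⟩
  · calc f * v * e * u * f * (f * v * e * u * f)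
        = f * v * e * (u * (f * f) * v) * e * (u * f) := by simp only [mul_assoc]
      _ = f * v * e * u * f := by
        rw [hff, ← h, mul_assoc _ e e, hee, mul_assoc _ e e, hee]; simp only [mul_assoc]
  · rw [mul_assoc, hff]
  · simp only [← mul_assoc, hff]
  · rintro h'
    rw [h'] at key
    exact hlt.2 key.le

end Rectangular

end Structure

/-! ### Simple modules -/

section SimpleModules

universe u v
variable {M : Type u} [Monoid M] [Finite M]

open MonoidAlgebra

omit [Finite M] in
-- The vector `u` generates the module, so if `m` killed every `n • u` it would kill everything.
lemma exists_mul_smul_ne_zero {k : Type*} [Field k] {V : Type*} [AddCommGroup V]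
    [Module (MonoidAlgebra k M) V] [IsSimpleModule (MonoidAlgebra k M) V] {m : M} {u w : V}
    (hw : of k M m • w ≠ 0) (hu : u ≠ 0) : ∃ n : M, of k M (m * n) • u ≠ 0 := by
  by_contra! h
  obtain ⟨a, rfl⟩ := IsSimpleModule.toSpanSingleton_surjective (MonoidAlgebra k M) hu w
  apply hw
  clear hw
  rw [LinearMap.toSpanSingleton_apply]
  induction a using MonoidAlgebra.induction_linear with
  | zero => simp
  | add x y hx hy => rw [add_smul, smul_add, hx, hy, add_zero]
  | single n c =>
    have : of k M m • single n c • u = algebraMap k (MonoidAlgebra k M) c • of k M (m * n) • u := by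
      rw [← mul_smul, ← mul_smul]
      congr 1
      simp [of_apply, single_mul_single]
    rw [this, h, smul_zero]

/-- A simple module contains an eigenvector for the character attached to a primary ideal. -/
lemma exists_eigenvector (k : Type v) [Field k] (hrect : IsRectangular M)
    (htriv : HasTrivialMaximalSubgroups M) (V : Type*) [AddCommGroup V]
    [Module (MonoidAlgebra k M) V] [IsSimpleModule (MonoidAlgebra k M) V] :
    ∃ (X : SupportLattice M) (v : V), v ≠ 0 ∧
      ∀ a : MonoidAlgebra k M, a • v = algebraMap k (MonoidAlgebra k M) (supportAlgHom k X a) • v := by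
  have hnt : Nontrivial V := IsSimpleModule.nontrivial (MonoidAlgebra k M) V
  obtain ⟨v₀, hv₀⟩ := exists_ne (0 : V)
  -- The elements not annihilating `V`. A minimal ideal among theirs is the apex of `V`; the next
  -- steps find an idempotent generating it.
  let S : Set M := {m | ∃ w : V, of k M m • w ≠ 0}
  have hS1 : (1 : M) ∈ S := ⟨v₀, by rw [map_one, one_smul]; exact hv₀⟩
  obtain ⟨m, ⟨w, hw⟩, hmin⟩ := S.toFinite.exists_minimalFor (fun m : M => principalIdeal m) S ⟨1, hS1⟩
  have hmin' : ∀ n ∈ S, principalIdeal n ⊆ principalIdeal m → principalIdeal m ⊆ principalIdeal n :=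
    fun n hn h => hmin hn h
  obtain ⟨n, hn⟩ := exists_mul_smul_ne_zero hw hw
  rw [← mul_smul, ← map_mul] at hn
  obtain ⟨a, b, hab⟩ := principalIdeal_subset_iff.1 (hmin' _ ⟨w, hn⟩
    (principalIdeal_mul_subset_right _ _))
  -- Iterating `m = a(mnm)b` shows that no power of `amn` annihilates `V`; one of these powers is
  -- idempotent.
  have hpow : ∀ j : ℕ, m = (a * m * n) ^ j * m * b ^ j := by
    intro j
    induction j with
    | zero => simp
    | succ j ih =>
      calc m = (a * m * n) ^ j * m * b ^ j := ih
        _ = (a * m * n) ^ j * (a * (m * n * m) * b) * b ^ j := by rw [← hab]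
        _ = _ := by rw [pow_succ, pow_succ']; simp only [mul_assoc]
  obtain ⟨j, hj, he⟩ := exists_pow_isIdempotentElem (a * m * n)
  obtain ⟨j, rfl⟩ := Nat.exists_eq_succ_of_ne_zero hj
  set e := (a * m * n) ^ (j + 1) with he_def
  have heS : e ∈ S := by
    refine ⟨of k M (m * b ^ (j + 1)) • w, ?_⟩
    rw [← mul_smul, ← map_mul, ← mul_assoc, ← hpow]
    exact hw
  have hem : principalIdeal e ⊆ principalIdeal m :=
    principalIdeal_subset_iff.2 ⟨(a * m * n) ^ j * a, n, by
      rw [he_def, pow_succ]; simp only [mul_assoc]⟩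
  have hmine : ∀ n ∈ S, principalIdeal n ⊆ principalIdeal e → principalIdeal e ⊆ principalIdeal n :=
    fun n hn h => hem.trans (hmin' n hn (h.trans hem))
  obtain ⟨w', hw'⟩ := heS
  have hnot : ∀ n : M, n ∉ aboveSet (principalIdeal e) → ∀ u : V, of k M n • u = 0 := by
    intro n hn u
    by_contra hu
    obtain ⟨p, hp⟩ := exists_mul_smul_ne_zero hu hw'
    rw [← mul_smul, ← map_mul] at hp
    refine hn ?_
    obtain ⟨c, d, h⟩ := principalIdeal_subset_iff.1 (hmine _ ⟨w', hp⟩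
      (principalIdeal_mul_subset_right _ _))
    exact mem_aboveSet_principalIdeal.2 ⟨c, p * e * d, by
      conv_lhs => rw [h]
      simp only [mul_assoc]⟩
  let X : SupportLattice M := ⟨principalIdeal e, isPrimary_principalIdeal hrect he⟩
  -- Otherwise the difference `(n - 1)e • w'` generates `V`, so some `ep` does not kill it. But if
  -- `p` is above `e`, then `epne = e = epe`; if not, `ep` annihilates `V`.
  have hin : ∀ n ∈ aboveSet (principalIdeal e), of k M n • of k M e • w' = of k M e • w' := by
    intro n hn
    by_contra h
    obtain ⟨p, hp⟩ := exists_mul_smul_ne_zero hw' (sub_ne_zero.2 h)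
    apply hp
    rw [smul_sub, ← mul_smul, ← mul_smul, ← map_mul, ← map_mul, ← mul_smul, ← map_mul]
    by_cases hpX : p ∈ aboveSet (principalIdeal e)
    · rw [mul_assoc e p n, idem_mul_mul_idem hrect htriv he (mul_mem_aboveSet hrect he hpX hn),
        idem_mul_mul_idem hrect htriv he hpX, sub_self]
    · have h1 : ∀ q, e * p * q ∉ aboveSet (principalIdeal e) :=
        fun q h => hpX (mem_aboveSet_right (mem_aboveSet_left h))
      rw [mul_assoc, hnot _ (h1 _), hnot _ (h1 _), sub_self]
  refine ⟨X, of k M e • w', hw', fun a => ?_⟩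
  induction a using MonoidAlgebra.induction_linear with
  | zero => simp
  | add x y hx hy => rw [add_smul, hx, hy, map_add, map_add, add_smul]
  | single n c =>
    have h1 : (single n c : MonoidAlgebra k M) = algebraMap k _ c * of k M n := by
      simp [of_apply, single_mul_single]
    have h2 : supportAlgHom k X (single n c) = c * supportChar k X n := by
      rw [supportAlgHom, lift_single, smul_eq_mul]
    rw [h1, ← h1, h2, h1, mul_smul, map_mul, mul_smul]
    congr 1
    by_cases hn : n ∈ aboveSet (principalIdeal e)
    · rw [hin n hn, show supportChar k X n = 1 from if_pos hn, map_one, one_smul]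
    · rw [hnot n hn, show supportChar k X n = 0 from if_neg hn, map_zero, zero_smul]

end SimpleModules

/-! ### `Ext¹` of one-dimensional modules via derivations -/

section Derivations

open CategoryTheory MonoidAlgebra

universe u v

variable {M : Type u} [Monoid M] {k : Type v} [Field k]

/-- The maps `d : M → k` with `d (m * n) = φ m * d n + d m * ψ n`. -/
def derivations (φ ψ : M → k) : Submodule k (M → k) where
  carrier := {d | ∀ m n, d (m * n) = φ m * d n + d m * ψ n}
  zero_mem' := by simp
  add_mem' := by
    intro a b ha hb m n
    simp only [Pi.add_apply, ha m n, hb m n]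
    ring
  smul_mem' := by
    intro c a ha m n
    simp only [Pi.smul_apply, smul_eq_mul, ha m n]
    ring

/-- The space of inner derivations, spanned by `φ - ψ`. -/
def innerDerivations (φ ψ : M → k) : Submodule k (M → k) := Submodule.span k {φ - ψ}

omit [Monoid M] in
lemma mem_innerDerivations {φ ψ d : M → k} :
    d ∈ innerDerivations φ ψ ↔ ∃ c : k, ∀ m, d m = c * (φ m - ψ m) := by
  rw [innerDerivations, Submodule.mem_span_singleton]
  refine exists_congr fun c => ?_
  rw [eq_comm, funext_iff]
  simp

lemma innerDerivations_le (φ ψ : M →* k) : innerDerivations (φ : M → k) ψ ≤ derivations φ ψ := by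
  intro d hd m n
  obtain ⟨c, hc⟩ := mem_innerDerivations.1 hd
  simp only [hc, map_mul]
  ring

lemma derivation_one {φ ψ : M →* k} {d : M → k} (hd : d ∈ derivations (φ : M → k) ψ) :
    d 1 = 0 := by
  have := hd 1 1
  simpa using this

/-- The linear extension of a function on `M` to `kM`. -/
noncomputable def linExt (d : M → k) : MonoidAlgebra k M →ₗ[k] k :=
  Finsupp.linearCombination k d ∘ₗ (coeffLinearEquiv k).toLinearMap

omit [Monoid M] in
@[simp]
lemma linExt_single (d : M → k) (m : M) (c : k) : linExt d (single m c) = c * d m := by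
  change Finsupp.linearCombination k d (Finsupp.single m c) = _
  simp

omit [Monoid M] in
lemma linExt_add (d d' : M → k) : linExt (d + d') = linExt d + linExt d' := by
  ext m
  simp [mul_add]

omit [Monoid M] in
lemma linExt_smul (c : k) (d : M → k) : linExt (c • d) = c • linExt d := by
  ext m
  simp

variable (X Y : SupportLattice M)

@[simp]
lemma supportAlgHom_single (m : M) (c : k) :
    supportAlgHom k X (single m c) = c * supportChar k X m := by
  rw [supportAlgHom, lift_single, smul_eq_mul]

lemma linExt_mul {X Y : SupportLattice M} {d : M → k}
    (hd : d ∈ derivations (supportChar k Y : M → k) (supportChar k X)) (a b : MonoidAlgebra k M) :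
    linExt d (a * b) = supportAlgHom k Y a * linExt d b + linExt d a * supportAlgHom k X b := by
  induction a using MonoidAlgebra.induction_linear with
  | zero => simp
  | add x y hx hy => rw [add_mul, map_add, hx, hy, map_add, map_add]; ring
  | single m c =>
    induction b using MonoidAlgebra.induction_linear with
    | zero => simp
    | add x y hx hy => rw [mul_add, map_add, hx, hy, map_add, map_add]; ring
    | single n c' =>
      rw [single_mul_single]
      simp only [linExt_single, supportAlgHom_single, hd m n]
      ring

variable [Finite M]

/-- A copy of the left regular module of `kM` in the universe of `k`. -/
abbrev RegModule (k : Type v) [Field k] (M : Type u) [Monoid M] [Finite M] : Type v := Shrink.{v} (MonoidAlgebra k M)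

/-- The comparison of `RegModule` with `kM`. -/
noncomputable abbrev regEquiv (k : Type v) [Field k] (M : Type u) [Monoid M] [Finite M] : RegModule k M ≃ₗ[MonoidAlgebra k M] MonoidAlgebra k M :=
  Shrink.linearEquiv _ _

variable (k) in
/-- The augmentation from the regular module to the one-dimensional module of `X`. -/
noncomputable def augmentation : RegModule k M →ₗ[MonoidAlgebra k M] supportModule k X where
  toFun x := supportAlgHom k X (regEquiv k M x)
  map_add' x y := by rw [map_add, map_add]; rfl
  map_smul' a x := by rw [map_smul, smul_eq_mul, map_mul]; rfl

lemma mem_ker_augmentation {x : RegModule k M} :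
    x ∈ LinearMap.ker (augmentation k X) ↔ supportAlgHom k X (regEquiv k M x) = 0 := Iff.rfl

lemma augmentation_surjective : Function.Surjective (augmentation k X) := by
  intro c
  let c' : k := c
  refine ⟨(regEquiv k M).symm (algebraMap k _ c'), ?_⟩
  change supportAlgHom k X (regEquiv k M ((regEquiv k M).symm _)) = c'
  rw [LinearEquiv.apply_symm_apply, AlgHom.commutes]
  rfl

/-- The homomorphism on the kernel of the augmentation attached to a derivation. -/
noncomputable def derivationHom
    (d : derivations (supportChar k Y : M → k) (supportChar k X)) :
    LinearMap.ker (augmentation k X) →ₗ[MonoidAlgebra k M] supportModule k Y where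
  toFun x := linExt d.1 (regEquiv k M x.1)
  map_add' x y := by rw [Submodule.coe_add, map_add, map_add]; rfl
  map_smul' a x := by
    -- The term of the Leibniz rule that obstructs linearity contains `χ_X(x)`, which is zero on the
    -- kernel.
    rw [Submodule.coe_smul, map_smul, smul_eq_mul, linExt_mul d.2,
      (mem_ker_augmentation X).1 x.2, mul_zero, add_zero]
    rfl

/-- The short exact sequence presenting the one-dimensional module of `X`. -/
lemma augmentation_shortExact : (augmentation k X).shortComplexKer.ShortExact :=
  LinearMap.shortExact_shortComplexKer (augmentation_surjective X)

/-- The connecting map from derivations to `Ext¹`. -/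
noncomputable def derivationToExt :
    derivations (supportChar k Y : M → k) (supportChar k X) →ₗ[k]
      Abelian.Ext.{v} (supportModule k X) (supportModule k Y) 1 where
  toFun d := (augmentation_shortExact X).extClass.comp
    (Abelian.Ext.mk₀ (ModuleCat.ofHom (derivationHom X Y d))) (add_zero 1)
  map_add' d d' := by
    rw [← Abelian.Ext.comp_add, ← Abelian.Ext.mk₀_add, ← ModuleCat.ofHom_add]
    congr 3
    ext x
    change linExt (d.1 + d'.1) _ = linExt d.1 _ + linExt d'.1 _
    rw [linExt_add]
    rfl
  map_smul' c d := by
    rw [RingHom.id_apply, ← Abelian.Ext.comp_smul, ← Abelian.Ext.mk₀_smul]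
    congr 2
    ext x
    change linExt (c • d.1) _ = supportAlgHom k Y (algebraMap k _ c) * linExt d.1 _
    rw [linExt_smul, AlgHom.commutes]
    rfl

/-- The projection of `kM` onto the kernel of the augmentation. -/
noncomputable def toKerAugmentation (a : MonoidAlgebra k M) : LinearMap.ker (augmentation k X) :=
  ⟨(regEquiv k M).symm (a - algebraMap k _ (supportAlgHom k X a)), by
    rw [mem_ker_augmentation, LinearEquiv.apply_symm_apply, map_sub, AlgHom.commutes]
    exact sub_self _⟩

lemma toKerAugmentation_regEquiv (x : LinearMap.ker (augmentation k X)) :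
    toKerAugmentation X (regEquiv k M x.1) = x := by
  apply Subtype.ext
  change (regEquiv k M).symm _ = _
  rw [(mem_ker_augmentation X).1 x.2, map_zero, sub_zero, LinearEquiv.symm_apply_apply]

lemma toKerAugmentation_add (a b : MonoidAlgebra k M) :
    toKerAugmentation X (a + b) = toKerAugmentation X a + toKerAugmentation X b := by
  apply Subtype.ext
  change (regEquiv k M).symm _ = (regEquiv k M).symm _ + (regEquiv k M).symm _
  rw [← map_add, map_add, map_add]
  congr 1
  abel

lemma toKerAugmentation_mul (a b : MonoidAlgebra k M) :
    toKerAugmentation X (a * b) = a • toKerAugmentation X b +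
      algebraMap k (MonoidAlgebra k M) (supportAlgHom k X b) • toKerAugmentation X a := by
  apply Subtype.ext
  change (regEquiv k M).symm _ = a • (regEquiv k M).symm _ + _ • (regEquiv k M).symm _
  rw [← map_smul, ← map_smul, ← map_add, smul_eq_mul, smul_eq_mul, mul_sub, mul_sub, map_mul,
    ← Algebra.commutes _ a, ← map_mul (algebraMap k (MonoidAlgebra k M)),
    mul_comm (supportAlgHom k X b)]
  congr 1
  abel

/-- Since `kM` is projective, every class comes from a homomorphism `F` on the kernel of the
augmentation; then `m ↦ F(m - χ_X(m))` is a derivation inducing `F`. -/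
lemma derivationToExt_surjective : Function.Surjective (derivationToExt (k := k) X Y) := by
  intro x
  have hP : Projective (augmentation k X).shortComplexKer.X₂ :=
    ModuleCat.projective_of_free (M := ModuleCat.of (MonoidAlgebra k M) (RegModule k M))
      (Module.Basis.ofEquivFun (ι := Unit)
        ((regEquiv k M).trans (LinearEquiv.funUnique Unit _ _).symm))
  obtain ⟨x₁, rfl⟩ := Abelian.Ext.contravariant_sequence_exact₃ (augmentation_shortExact X)
    (supportModule k Y) x (Abelian.Ext.eq_zero_of_projective _) (add_zero 1)
  obtain ⟨f, rfl⟩ := (Abelian.Ext.mk₀_bijective _ _).2 x₁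
  let F : LinearMap.ker (augmentation k X) →ₗ[MonoidAlgebra k M] supportModule k Y := f.hom
  let d : M → k := fun m => F (toKerAugmentation X (of k M m))
  have hd : d ∈ derivations (supportChar k Y : M → k) (supportChar k X) := by
    intro m n
    change F _ = _
    rw [map_mul, toKerAugmentation_mul, map_add, map_smul, map_smul]
    change supportAlgHom k Y (of k M m) * d n + supportAlgHom k Y (algebraMap k _ _) * d m = _
    rw [AlgHom.commutes, of_apply, of_apply, supportAlgHom_single, supportAlgHom_single, one_mul,
      one_mul, Algebra.algebraMap_self, RingHom.id_apply, mul_comm (d m)]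
  have hF : ∀ a : MonoidAlgebra k M, linExt d a = F (toKerAugmentation X a) := by
    intro a
    induction a using MonoidAlgebra.induction_linear with
    | zero =>
      have h := toKerAugmentation_add (k := k) X 0 0
      rw [add_zero, left_eq_add] at h
      rw [h, map_zero, map_zero]
      rfl
    | add x y hx hy => rw [toKerAugmentation_add, map_add, map_add, hx, hy]; rfl
    | single n c =>
      have h1 : (single n c : MonoidAlgebra k M) = algebraMap k _ c * of k M n := by
        simp [of_apply, single_mul_single]
      have h2 : toKerAugmentation X (algebraMap k (MonoidAlgebra k M) c) = 0 := by
        apply Subtype.ext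
        change (regEquiv k M).symm _ = 0
        rw [AlgHom.commutes, Algebra.algebraMap_self, RingHom.id_apply, sub_self, map_zero]
      rw [linExt_single, h1, toKerAugmentation_mul, h2, smul_zero, add_zero, map_smul]
      change _ = supportAlgHom k Y (algebraMap k _ c) * d n
      rw [AlgHom.commutes]
      rfl
  refine ⟨⟨d, hd⟩, ?_⟩
  change (augmentation_shortExact X).extClass.comp
    (Abelian.Ext.mk₀ (ModuleCat.ofHom (derivationHom X Y ⟨d, hd⟩))) (add_zero 1) = _
  congr 2
  ext x
  change linExt d (regEquiv k M x.1) = F x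
  rw [hF, toKerAugmentation_regEquiv]

/-- The class of `d` vanishes exactly when its homomorphism extends to `kM`. The maps `kM → S_Y` are
`a ↦ χ_Y(a)c`, and on `m - χ_X(m)` they take the value `c(φ(m) - ψ(m))`. -/
lemma ker_derivationToExt : LinearMap.ker (derivationToExt (k := k) X Y) =
    (innerDerivations (supportChar k Y : M → k) (supportChar k X)).comap
      (derivations (supportChar k Y : M → k) (supportChar k X)).subtype := by
  ext d
  rw [LinearMap.mem_ker, Submodule.mem_comap, Submodule.subtype_apply, mem_innerDerivations]
  constructor
  · intro h
    obtain ⟨x₂, hx₂⟩ := Abelian.Ext.contravariant_sequence_exact₁ (augmentation_shortExact X)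
      (supportModule k Y) _ (add_zero 1) h
    obtain ⟨g, rfl⟩ := (Abelian.Ext.mk₀_bijective _ _).2 x₂
    rw [Abelian.Ext.mk₀_comp_mk₀] at hx₂
    have hg := (Abelian.Ext.mk₀_bijective _ _).1 hx₂
    let G : RegModule k M →ₗ[MonoidAlgebra k M] supportModule k Y := g.hom
    have hG : ∀ x : LinearMap.ker (augmentation k X), G x.1 = derivationHom X Y d x :=
      fun x => congrArg (fun h => h.hom x) hg
    let c : k := G ((regEquiv k M).symm 1)
    have hc : ∀ a : MonoidAlgebra k M, G ((regEquiv k M).symm a) = supportAlgHom k Y a * c := by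
      intro a
      conv_lhs => rw [← mul_one a, ← smul_eq_mul, map_smul, map_smul]
      rfl
    refine ⟨c, fun m => ?_⟩
    have h1 := hG (toKerAugmentation X (of k M m))
    change G ((regEquiv k M).symm _) = linExt d.1 (regEquiv k M ((regEquiv k M).symm _)) at h1
    rw [hc, LinearEquiv.apply_symm_apply, map_sub, map_sub, AlgHom.commutes, of_apply,
      supportAlgHom_single, supportAlgHom_single, linExt_single, coe_algebraMap] at h1
    simp only [Function.comp_apply, linExt_single, derivation_one d.2, one_mul, mul_zero, sub_zero,
      Algebra.algebraMap_self, RingHom.id_apply] at h1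
    rw [← h1, mul_comm]
  · rintro ⟨c, hc⟩
    let G : RegModule k M →ₗ[MonoidAlgebra k M] supportModule k Y :=
      { toFun := fun x => supportAlgHom k Y (regEquiv k M x) * c
        map_add' := fun x y => by rw [map_add, map_add, add_mul]; rfl
        map_smul' := fun a x => by rw [map_smul, smul_eq_mul, map_mul, mul_assoc]; rfl }
    have hlin : ∀ a : MonoidAlgebra k M,
        linExt d.1 a = c * (supportAlgHom k Y a - supportAlgHom k X a) := by
      intro a
      induction a using MonoidAlgebra.induction_linear with
      | zero => simp
      | add x y hx hy => rw [map_add, hx, hy, map_add, map_add]; ring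
      | single n b => rw [linExt_single, hc, supportAlgHom_single, supportAlgHom_single]; ring
    have hfac : ModuleCat.ofHom (derivationHom X Y d) =
        (augmentation k X).shortComplexKer.f ≫ ModuleCat.ofHom G := by
      ext x
      change linExt d.1 (regEquiv k M x.1) = supportAlgHom k Y (regEquiv k M x.1) * c
      rw [hlin, (mem_ker_augmentation X).1 x.2, sub_zero, mul_comm]
    change (augmentation_shortExact X).extClass.comp
      (Abelian.Ext.mk₀ (ModuleCat.ofHom (derivationHom X Y d))) (add_zero 1) = 0
    rw [hfac, ← Abelian.Ext.mk₀_comp_mk₀, ShortComplex.ShortExact.extClass_comp_assoc]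

/-- The number of arrows is the codimension of the inner derivations in the derivations. -/
lemma numArrows_eq {n : ℕ}
    (h : n + Module.finrank k (innerDerivations (supportChar k Y : M → k) (supportChar k X)) =
      Module.finrank k (derivations (supportChar k Y : M → k) (supportChar k X))) :
    numArrows k (MonoidAlgebra k M) (supportVertex k X) (supportVertex k Y) = (n : Cardinal) := by
  change Module.rank k (Abelian.Ext.{v} (supportModule k X) (supportModule k Y) 1) = _
  have hfin : Module.Finite k (Abelian.Ext.{v} (supportModule k X) (supportModule k Y) 1) :=
    Module.Finite.of_surjective _ (derivationToExt_surjective X Y)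
  rw [← Module.finrank_eq_rank]
  congr 1
  have h1 := (derivationToExt (k := k) X Y).finrank_range_add_finrank_ker
  rw [LinearMap.range_eq_top.2 (derivationToExt_surjective X Y), finrank_top, ker_derivationToExt,
    (Submodule.comapSubtypeEquivOfLe (innerDerivations_le _ _)).finrank_eq] at h1
  omega

end Derivations

/-! ### Splitting and the vertices of the quiver -/

section Vertices

open CategoryTheory MonoidAlgebra

universe u v

variable {M : Type u} [Monoid M] [Finite M] (k : Type v) [Field k]

omit [Finite M] in
lemma supportAlgHom_surjective (X : SupportLattice M) :
    Function.Surjective (supportAlgHom k X) := fun c => ⟨algebraMap k _ c, by simp⟩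

/-- The product of the characters of all primary ideals. -/
noncomputable def supportAlgHoms : MonoidAlgebra k M →ₐ[k] (SupportLattice M → k) :=
  AlgHom.pi fun X => supportAlgHom k X

/-- An idempotent generator of `X` maps to the indicator of `{Z | Z ≤ X}`, so the images are
unitriangular for inclusion, and induction on `X` reaches every coordinate vector. -/
lemma supportAlgHoms_surjective : Function.Surjective (supportAlgHoms k (M := M)) := by
  classical
  have := Fintype.ofFinite (SupportLattice M)
  rw [← AlgHom.coe_toLinearMap, ← LinearMap.range_eq_top, Submodule.eq_top_iff']
  have hsingle : ∀ X : SupportLattice M,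
      Pi.single X (1 : k) ∈ LinearMap.range (supportAlgHoms k (M := M)).toLinearMap := by
    intro X
    induction X using WellFoundedLT.induction with
    | ind X ih =>
      obtain ⟨e, -, heX⟩ := exists_idem_generator X.2
      have hval : Pi.single X (1 : k) = (supportAlgHoms k (M := M)).toLinearMap (of k M e) -
          ∑ Y ∈ Finset.univ.filter (· < X), Pi.single Y (1 : k) := by
        ext Z
        have h1 : (supportAlgHoms k (M := M)).toLinearMap (of k M e) Z = if Z ≤ X then 1 else 0 := by
          change supportAlgHom k Z (single e 1) = _
          rw [supportAlgHom_single, one_mul]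
          change (if e ∈ aboveSet Z.1 then (1 : k) else 0) = _
          congr 1
          rw [← Subtype.coe_le_coe, ← heX]
          rfl
        rw [Pi.sub_apply, h1, Finset.sum_apply]
        simp only [Pi.single_apply, Finset.sum_ite_eq, Finset.mem_filter, Finset.mem_univ,
          true_and]
        rcases eq_or_ne Z X with rfl | hne
        · simp
        · by_cases hle : Z ≤ X
          · simp [hne, hle, lt_of_le_of_ne hle hne]
          · simp [hne, hle, show ¬ Z < X from fun h => hle h.le]
      rw [hval]
      exact sub_mem ⟨_, rfl⟩ (sum_mem fun Y hY => ih Y (Finset.mem_filter.1 hY).2)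
  intro f
  rw [pi_eq_sum_univ' f]
  refine sum_mem fun X _ => ?_
  convert Submodule.smul_mem _ (f X) (hsingle X) using 2

variable (hrect : IsRectangular M) (htriv : HasTrivialMaximalSubgroups M)
include hrect htriv

/-- Each character has a maximal kernel, which gives one inclusion. For the other, `kM/I` with `I`
maximal is generated by an eigenvector of some `χ_X`, so an element killed by all characters sends
the class of `1` to zero. -/
lemma jacobson_eq_ker :
    Ring.jacobson (MonoidAlgebra k M) = RingHom.ker (supportAlgHoms k (M := M)) := by
  apply le_antisymm
  · intro a ha
    rw [RingHom.mem_ker]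
    ext X
    have := RingHom.ker_isMaximal_of_surjective _ (supportAlgHom_surjective k X)
    exact RingHom.mem_ker.1 (Ring.jacobson_le_of_isMaximal (RingHom.ker (supportAlgHom k X)) ha)
  · intro a ha
    rw [Ring.jacobson_eq_sInf_isMaximal, Submodule.mem_sInf]
    intro I hI
    have hsimple : IsSimpleModule (MonoidAlgebra k M) (MonoidAlgebra k M ⧸ I) :=
      isSimpleModule_iff_isCoatom.2 hI.1
    obtain ⟨X, v, hv, hav⟩ := exists_eigenvector k hrect htriv (MonoidAlgebra k M ⧸ I)
    obtain ⟨b, hb⟩ := IsSimpleModule.toSpanSingleton_surjective (MonoidAlgebra k M) hv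
      (Submodule.Quotient.mk 1)
    rw [LinearMap.toSpanSingleton_apply] at hb
    have haX : supportAlgHom k X a = 0 := congrFun (RingHom.mem_ker.1 ha) X
    rw [← Submodule.Quotient.mk_eq_zero, ← mul_one a, ← smul_eq_mul, Submodule.Quotient.mk_smul,
      ← hb, ← mul_smul, hav, map_mul, haX, zero_mul, map_zero, zero_smul]

lemma isSplit_monoidAlgebra : IsSplit k (MonoidAlgebra k M) := by
  obtain ⟨n, ⟨φ⟩⟩ := Finite.exists_equiv_fin (SupportLattice M)
  refine ⟨n, fun _ => 1, ⟨?_⟩⟩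
  refine (Ideal.quotientEquivAlgOfEq k (jacobson_eq_ker k hrect htriv)).trans ?_
  refine (Ideal.quotientKerAlgEquivOfSurjective (supportAlgHoms_surjective k)).trans ?_
  refine (AlgEquiv.piCongrLeft' k (fun _ => k) φ).trans ?_
  have h : (Matrix (Fin 1) (Fin 1) k) ≃ₐ[k] k := by
    convert Matrix.uniqueAlgEquiv (m := Fin 1) (A := k) (R := k)
  exact AlgEquiv.piCongrRight fun _ => h.symm

/-- Isomorphic modules have equal characters, hence equal sets `M_X`, and each of two ideals with
the same such set contains the other. Conversely an eigenvector in a simple module gives a nonzero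
map from some `S_X`, an isomorphism by Schur's lemma. -/
lemma supportVertex_bijective :
    Function.Bijective (fun X : SupportLattice M => supportVertex k X) := by
  constructor
  · intro X Y h
    obtain ⟨i⟩ := Quotient.exact h
    let L : supportModule k X →ₗ[MonoidAlgebra k M] supportModule k Y := i.hom.hom
    have hL : Function.Injective L := i.toLinearEquiv.injective
    let one : supportModule k X := (1 : k)
    let c : k := L one
    have hc : c ≠ 0 := fun h0 => one_ne_zero (α := k) (hL (h0.trans (map_zero L).symm))
    have key : ∀ m, supportChar k X m = supportChar k Y m := by
      intro m
      have h1 : of k M m • one = algebraMap k (MonoidAlgebra k M) (supportChar k X m) • one := by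
        change supportAlgHom k X _ * (1 : k) = supportAlgHom k X _ * (1 : k)
        rw [AlgHom.commutes, of_apply, supportAlgHom_single, one_mul]
        rfl
      have h2 := congrArg L h1
      rw [map_smul, map_smul] at h2
      change supportAlgHom k Y _ * c = supportAlgHom k Y _ * c at h2
      rw [AlgHom.commutes, of_apply, supportAlgHom_single, one_mul] at h2
      exact (mul_right_cancel₀ hc h2).symm
    have hset : ∀ m, m ∈ aboveSet X.1 ↔ m ∈ aboveSet Y.1 := by
      intro m
      classical
      have := key m
      change (if m ∈ aboveSet X.1 then (1 : k) else 0) = if m ∈ aboveSet Y.1 then 1 else 0 at this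
      by_cases h1 : m ∈ aboveSet X.1 <;> by_cases h2 : m ∈ aboveSet Y.1 <;> simp_all
    obtain ⟨x, hx⟩ := X.2.1
    obtain ⟨y, hy⟩ := Y.2.1
    apply Subtype.ext
    apply Set.Subset.antisymm
    · have : y ∈ aboveSet X.1 := (hset y).2 (by rw [hy]; exact self_mem_aboveSet y)
      exact hy ▸ this
    · have : x ∈ aboveSet Y.1 := (hset x).1 (by rw [hx]; exact self_mem_aboveSet x)
      exact hx ▸ this
  · intro q
    obtain ⟨⟨S, hS⟩, rfl⟩ := Quotient.exists_rep q
    obtain ⟨X, v, hv, hav⟩ := exists_eigenvector k hrect htriv S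
    have hX := isSimpleModule_supportModule k X
    let L : supportModule k X →ₗ[MonoidAlgebra k M] S :=
      { toFun := fun c => algebraMap k (MonoidAlgebra k M) (c : k) • v
        map_add' := fun c d => by
          rw [← add_smul]
          exact congrArg (· • v) (map_add (algebraMap k (MonoidAlgebra k M)) (c : k) d)
        map_smul' := fun a c => by
          let c' : k := c
          change algebraMap k (MonoidAlgebra k M) (supportAlgHom k X a * c') • v =
            a • algebraMap k (MonoidAlgebra k M) c' • v
          rw [← mul_smul, ← Algebra.commutes c' a, mul_smul, hav a, ← mul_smul,
            ← map_mul, mul_comm] }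
    have hL : L ≠ 0 := by
      intro h
      apply hv
      have h1 : algebraMap k (MonoidAlgebra k M) 1 • v = 0 :=
        congrArg (fun f => f (1 : k)) h
      rwa [map_one, one_smul] at h1
    refine ⟨X, Quotient.sound ⟨?_⟩⟩
    exact (LinearEquiv.ofBijective L (LinearMap.bijective_of_ne_zero hL)).toModuleIso

end Vertices

/-! ### The spaces `V_{X,Y}` and derivations -/

/-! ### Duals of quotients of free vector spaces. -/

section Annihilators

variable {α k : Type*} [Field k]

/-- The functions on `α` whose linear extensions vanish on `S`. -/
def annihilatingFunctions (S : Set (α →₀ k)) : Submodule k (α → k) where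
  carrier := {F | ∀ s ∈ S, Finsupp.linearCombination k F s = 0}
  zero_mem' := by
    intro s _
    simp
  add_mem' := by
    intro F G hF hG s hs
    have h : Finsupp.linearCombination k (F + G) =
        Finsupp.linearCombination k F + Finsupp.linearCombination k G := by
      ext
      simp
    rw [h, LinearMap.add_apply, hF s hs, hG s hs, add_zero]
  smul_mem' := by
    intro c F hF s hs
    have h : Finsupp.linearCombination k (c • F) = c • Finsupp.linearCombination k F := by
      ext
      simp
    rw [h, LinearMap.smul_apply, hF s hs, smul_zero]

/-- The dual of the quotient of `k[α]` by the span of `S`. -/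
noncomputable def dualQuotSpanEquiv (S : Set (α →₀ k)) :
    Module.Dual k ((α →₀ k) ⧸ Submodule.span k S) ≃ₗ[k] annihilatingFunctions S where
  toFun G := ⟨fun a => G (Submodule.Quotient.mk (Finsupp.single a 1)), by
    intro s hs
    have h : Finsupp.linearCombination k
        (fun a => G (Submodule.Quotient.mk (Finsupp.single a 1))) =
          G ∘ₗ (Submodule.span k S).mkQ := by
      ext
      simp
    rw [h, LinearMap.comp_apply, Submodule.mkQ_apply,
      (Submodule.Quotient.mk_eq_zero _).2 (Submodule.subset_span hs), map_zero]⟩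
  map_add' _ _ := rfl
  map_smul' _ _ := rfl
  invFun F := (Submodule.span k S).liftQ (Finsupp.linearCombination k F.1)
    (Submodule.span_le.2 F.2)
  left_inv G := by
    ext
    simp
  right_inv F := by
    ext
    simp

/-- Replaces a quotient by functions satisfying its relations, which can be compared directly with
derivations. -/
lemma finrank_quot_span [Finite α] (S : Set (α →₀ k)) :
    Module.finrank k ((α →₀ k) ⧸ Submodule.span k S) =
      Module.finrank k (annihilatingFunctions S) := by
  rw [← (dualQuotSpanEquiv S).finrank_eq, Subspace.dual_finrank_eq]

/-- A function constant on generating pairs is constant on the classes they generate, so only the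
generators need testing. -/
lemma mem_annihilatingFunctions_eqvGen {N : Set α} {r : α → α → Prop} {F : α → k} :
    F ∈ annihilatingFunctions ({v | ∃ z : α, z ∈ N ∧ v = Finsupp.single z (1 : k)} ∪
      {v | ∃ x y : α, Relation.EqvGen r x y ∧ v = Finsupp.single x 1 - Finsupp.single y 1}) ↔
    (∀ z ∈ N, F z = 0) ∧ ∀ x y, r x y → F x = F y := by
  constructor
  · intro h
    refine ⟨fun z hz => ?_, fun x y hxy => ?_⟩
    · simpa using h _ (Or.inl ⟨z, hz, rfl⟩)
    · simpa [sub_eq_zero] using h _ (Or.inr ⟨x, y, .rel _ _ hxy, rfl⟩)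
  · rintro ⟨h1, h2⟩ _ (⟨z, hz, rfl⟩ | ⟨x, y, hxy, rfl⟩)
    · simpa using h1 z hz
    · have : F x = F y := by
        induction hxy with
        | rel x y h => exact h2 x y h
        | refl x => rfl
        | symm x y _ ih => exact ih.symm
        | trans x y z _ _ ih1 ih2 => exact ih1.trans ih2
      simpa [sub_eq_zero] using this

end Annihilators

section Comparison

variable {M : Type*} [Monoid M] {k : Type*} [Field k]

/-- `φ` is the indicator function of the elements above the idempotent `e`, which satisfy
`eme = e`. -/
structure IsIndicator (φ : M →* k) (e : M) : Prop where
  idem : e * e = e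
  eq_one : ∀ {m}, m ∈ aboveSet (principalIdeal e) → φ m = 1
  eq_zero : ∀ {m}, m ∉ aboveSet (principalIdeal e) → φ m = 0
  corner_eq : ∀ {m}, m ∈ aboveSet (principalIdeal e) → e * m * e = e

namespace IsIndicator

variable {φ ψ : M →* k} {e f : M}

lemma self (h : IsIndicator φ e) : φ e = 1 := h.eq_one (self_mem_aboveSet e)

lemma cases (h : IsIndicator φ e) (m : M) :
    (φ m = 1 ∧ e * m * e = e) ∨ (φ m = 0 ∧ m ∈ notAbove (principalIdeal e)) := by
  by_cases hm : m ∈ aboveSet (principalIdeal e)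
  · exact Or.inl ⟨h.eq_one hm, h.corner_eq hm⟩
  · exact Or.inr ⟨h.eq_zero hm, hm⟩

lemma mem_notAbove (h : IsIndicator φ e) {m : M} (hm : φ m = 0) :
    m ∈ notAbove (principalIdeal e) := fun h' => one_ne_zero ((h.eq_one h').symm.trans hm)

lemma eq_zero_of_nullProducts (hφ : IsIndicator φ f) (hψ : IsIndicator ψ e) {d : M → k}
    (hd : d ∈ derivations (φ : M → k) ψ) {z : M} (hz : z ∈ nullProducts f e) : d z = 0 := by
  obtain ⟨m, hm, n, hn, rfl⟩ := hz
  rw [hd, hφ.eq_zero hm, hψ.eq_zero hn, zero_mul, mul_zero, add_zero]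

/-- Solved for `d m`, this reconstructs a derivation from its values on `fMe`, at `e` and at `f`; it
dictates the inverse maps below. -/
lemma derivation_corner (hφ : IsIndicator φ f) (hψ : IsIndicator ψ e) {d : M → k}
    (hd : d ∈ derivations (φ : M → k) ψ) (m : M) :
    d (f * m * e) = φ m * d e + d f * ψ m + d m := by
  rw [hd, hd, map_mul, hφ.self, hψ.self]
  ring

end IsIndicator

lemma toCorner_congr {f e m n : M} (h : f * m * e = f * n * e) :
    toCorner f e m = toCorner f e n := Subtype.ext h

lemma exists_toCorner {f e : M} (z : corner f e) : ∃ m, z = toCorner f e m :=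
  z.2.imp fun _ h => Subtype.ext h

/-! ### Derivations for incomparable ideals. -/

section Incomparable

variable {φ ψ : M →* k} {e f : M} (hφ : IsIndicator φ f) (hψ : IsIndicator ψ e)
  (hφe : φ e = 0) (hψf : ψ f = 0)

/-- The relations of the incomparable case. -/
lemma mem_annihilatingFunctions_incomparable {F : corner f e → k} :
    F ∈ annihilatingFunctions
      ({v | ∃ z : corner f e, (z : M) ∈ nullProducts f e ∧ v = Finsupp.single z (1 : k)} ∪
       {v | ∃ m n : M, v =
          Finsupp.single (toCorner f e (m * n)) 1
          + Finsupp.single (toCorner f e (m * f * e * n)) 1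
          - Finsupp.single (toCorner f e (m * f * n)) 1
          - Finsupp.single (toCorner f e (m * e * n)) 1}) ↔
    (∀ z : corner f e, (z : M) ∈ nullProducts f e → F z = 0) ∧
      ∀ m n, F (toCorner f e (m * n)) + F (toCorner f e (m * f * e * n))
        - F (toCorner f e (m * f * n)) - F (toCorner f e (m * e * n)) = 0 := by
  constructor
  · intro h
    refine ⟨fun z hz => ?_, fun m n => ?_⟩
    · simpa using h _ (Or.inl ⟨z, hz, rfl⟩)
    · simpa using h _ (Or.inr ⟨m, n, rfl⟩)
  · rintro ⟨h1, h2⟩ _ (⟨z, hz, rfl⟩ | ⟨m, n, rfl⟩)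
    · simpa using h1 z hz
    · simpa using h2 m n

include hφ hψ hφe hψf in
-- A derivation corresponds to its restriction to `fMe` together with the free scalar `d(e)`; `d(f)`
-- follows from `d(fe) = d(e) + d(f)`. The extra dimension will be absorbed by the inner
-- derivations.
lemma finrank_derivations_incomparable [Finite M] :
    Module.finrank k (VIncomparable k e f) + 1 =
      Module.finrank k (derivations (φ : M → k) ψ) := by
  rw [show Module.finrank k (VIncomparable k e f) = _ from finrank_quot_span _, ← Module.finrank_self k,
    ← Module.finrank_prod]
  refine (LinearEquiv.finrank_eq ?_).symm
  exact
  { toFun := fun d => (⟨fun z => d.1 z, mem_annihilatingFunctions_incomparable.2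
      ⟨fun z hz => hφ.eq_zero_of_nullProducts hψ d.2 hz, fun m n => by
        have hd := d.2
        simp only [toCorner, hφ.derivation_corner hψ hd, map_mul, hφe, hψf]
        simp only [hd _ _, map_mul, hφe, hψf, hφ.self, hψ.self]
        ring⟩⟩, d.1 e)
    map_add' := fun _ _ => rfl
    map_smul' := fun _ _ => rfl
    invFun := fun p => ⟨fun m => p.1.1 (toCorner f e m) - ψ m * p.1.1 (toCorner f e 1)
        + p.2 * (ψ m - φ m), by
      obtain ⟨⟨F, hF⟩, a⟩ := p
      obtain ⟨h0, h4⟩ := mem_annihilatingFunctions_incomparable.1 hF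
      have hnull : ∀ p q r, φ p = 0 → ψ q = 0 → f * r * e = p * q → F (toCorner f e r) = 0 :=
        fun p q r hp hq hr => h0 _ ⟨p, hφ.mem_notAbove hp, q, hψ.mem_notAbove hq, hr⟩
      intro m n
      have h := h4 m n
      dsimp only
      -- The four-term relation specialises to this in every case: `fmf = f` and `ene = e` collapse
      -- terms when `m`, `n` are above `f`, `e`, and otherwise the surviving mixed terms are null
      -- products because `φ e = ψ f = 0`.
      have key : F (toCorner f e (m * n)) = φ m * F (toCorner f e n) +
          ψ n * F (toCorner f e m) - φ m * ψ n * F (toCorner f e 1) := by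
        have hleft : f * m * f = f → toCorner f e (m * f * n) = toCorner f e n :=
          fun hfm => toCorner_congr <| by
            calc f * (m * f * n) * e = (f * m * f) * n * e := by simp only [mul_assoc]
              _ = f * n * e := by rw [hfm]
        have hright : e * n * e = e → toCorner f e (m * e * n) = toCorner f e m :=
          fun hen => toCorner_congr <| by
            calc f * (m * e * n) * e = f * m * (e * n * e) := by simp only [mul_assoc]
              _ = f * m * e := by rw [hen]
        rcases hφ.cases m with ⟨hm, hfm⟩ | ⟨hm, -⟩ <;> rcases hψ.cases n with ⟨hn, hen⟩ | ⟨hn, -⟩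
        · rw [toCorner_congr (m := m * f * e * n) (n := 1)
              (by
                calc f * (m * f * e * n) * e = (f * m * f) * (e * n * e) := by
                      simp only [mul_assoc]
                  _ = f * 1 * e := by rw [hfm, hen, mul_one]),
            hleft hfm,
            hright hen] at h
          rw [hm, hn]
          linear_combination h
        · rw [hleft hfm,
            hnull (f * e) (n * e) (m * f * e * n) (by simp [hφe]) (by simp [hn])
              (by
                calc f * (m * f * e * n) * e = (f * m * f) * e * n * e := by
                      simp only [mul_assoc]
                  _ = f * e * (n * e) := by rw [hfm]; simp only [mul_assoc]),
            hnull (f * m * e) (n * e) (m * e * n) (by simp [hφe]) (by simp [hn])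
              (by simp only [mul_assoc])] at h
          rw [hm, hn]
          linear_combination h
        · rw [hright hen,
            hnull (f * m) (f * e * n * e) (m * f * e * n) (by simp [hm]) (by simp [hψf])
              (by simp only [mul_assoc]),
            hnull (f * m) (f * n * e) (m * f * n) (by simp [hm]) (by simp [hψf])
              (by simp only [mul_assoc])] at h
          rw [hm, hn]
          linear_combination h
        · rw [hnull (f * m) (n * e) (m * n) (by simp [hm]) (by simp [hn])
            (by simp only [mul_assoc]), hm, hn]
          ring
      rw [key, map_mul, map_mul]
      ring⟩
    left_inv := fun d => by
      apply Subtype.ext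
      funext m
      change d.1 (f * m * e) - ψ m * d.1 (f * 1 * e) + d.1 e * (ψ m - φ m) = d.1 m
      rw [hφ.derivation_corner hψ d.2, hφ.derivation_corner hψ d.2, derivation_one d.2, map_one,
        map_one]
      ring
    right_inv := fun p => by
      obtain ⟨⟨F, hF⟩, a⟩ := p
      refine Prod.ext (Subtype.ext (funext fun z => ?_)) ?_
      · obtain ⟨m, rfl⟩ := exists_toCorner z
        change F (toCorner f e (f * m * e)) - ψ (f * m * e) * F _
          + a * (ψ (f * m * e) - φ (f * m * e)) = F (toCorner f e m)
        rw [toCorner_congr (m := f * m * e) (n := m)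
          (by simp only [mul_assoc, hψ.idem]; simp only [← mul_assoc, hφ.idem])]
        simp [hφe, hψf]
      · change F (toCorner f e e) - ψ e * F (toCorner f e 1) + a * (ψ e - φ e) = a
        rw [toCorner_congr (m := e) (n := 1) (by rw [mul_one, mul_assoc, hψ.idem]), hφe, hψ.self]
        ring }

end Incomparable

/-! ### Derivations for a single ideal. -/

section Equal

variable {φ : M →* k} {e : M} (hφ : IsIndicator φ e) (hG : maximalSubgroup e = {e})

include hφ hG in
-- Here `d(e) = 2d(e)` gives `d(e) = 0`, so `d` vanishes on `M_X` and `d(m) = d(eme)` everywhere;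
-- the restriction to `I_X` loses nothing.
lemma finrank_derivations_eq [Finite M] :
    Module.finrank k (VEq k e) = Module.finrank k (derivations (φ : M → k) φ) := by
  classical
  rw [show Module.finrank k (VEq k e) = _ from finrank_quot_span _]
  have hmem : ∀ {m}, φ m = 0 → e * m * e ∈ nonUnits e := by
    intro m hm
    refine ⟨⟨m, rfl⟩, ?_⟩
    rw [hG]
    intro h
    have : φ (e * m * e) = φ e := congrArg φ h
    simp [hm, hφ.self] at this
  have hzero : ∀ z ∈ nonUnits e, φ z = 0 := by
    rintro _ ⟨⟨m, rfl⟩, hz⟩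
    rcases hφ.cases m with ⟨-, h⟩ | ⟨h, -⟩
    · rw [hG] at hz
      exact absurd h hz
    · simp [h]
  have hone : ∀ d ∈ derivations (φ : M → k) φ, ∀ m, φ m = 1 → d m = 0 := by
    intro d hd m hm
    have he : d e = 0 := by
      have := hd e e
      rw [hφ.idem, hφ.self] at this
      linear_combination -this
    rcases hφ.cases m with ⟨-, h⟩ | ⟨h, -⟩
    · have := hφ.derivation_corner hφ hd m
      rw [h, he] at this
      linear_combination -this
    · exact absurd (hm.symm.trans h) one_ne_zero
  refine (LinearEquiv.finrank_eq ?_).symm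
  exact
  { toFun := fun d => ⟨fun z => d.1 z, mem_annihilatingFunctions_eqvGen.2
      ⟨fun z hz => hφ.eq_zero_of_nullProducts hφ d.2 hz, fun x y hxy => by
        have hd := d.2
        rcases hxy with ⟨m, n, -, hx, hy⟩ | ⟨hx, hy⟩
        · rw [hx, hy]
          have he := hone _ hd e hφ.self
          simp only [hφ.derivation_corner hφ hd, map_mul, hφ.self, he]
          simp only [hd _ _, map_mul, hφ.self, he]
          ring
        · rw [hφ.eq_zero_of_nullProducts hφ hd hx, hφ.eq_zero_of_nullProducts hφ hd hy]⟩⟩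
    map_add' := fun _ _ => rfl
    map_smul' := fun _ _ => rfl
    -- Off `M_X` the element `eme` lies in `I_X`; on `M_X` the value must be `0`.
    invFun := fun F => ⟨fun m => if h : φ m = 0 then F.1 ⟨e * m * e, hmem h⟩ else 0, by
      obtain ⟨F, hF⟩ := F
      obtain ⟨h0, hr⟩ := mem_annihilatingFunctions_eqvGen.1 hF
      intro m n
      have hstep : ∀ h : φ (m * n) = 0, F ⟨e * (m * n) * e, hmem h⟩ =
          F ⟨e * (m * e * n) * e, hmem (by simpa [hφ.self] using h)⟩ :=
        fun h => hr _ _ (Or.inl ⟨m, n, hφ.mem_notAbove h, rfl, rfl⟩)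
      rcases hφ.cases m with ⟨hm, hem⟩ | ⟨hm, -⟩ <;> rcases hφ.cases n with ⟨hn, hen⟩ | ⟨hn, -⟩
      · simp [hm, hn]
      · have h : φ (m * n) = 0 := by simp [hn]
        simp only [h, hm, hn, dif_pos, one_ne_zero, dif_neg, not_false_eq_true, one_mul, mul_zero,
          add_zero]
        rw [hstep h]
        congr 2
        calc e * (m * e * n) * e = (e * m * e) * n * e := by simp only [mul_assoc]
          _ = e * n * e := by rw [hem]
      · have h : φ (m * n) = 0 := by simp [hm]
        simp only [h, hm, hn, dif_pos, one_ne_zero, dif_neg, not_false_eq_true, mul_one, mul_zero,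
          zero_add]
        rw [hstep h]
        congr 2
        calc e * (m * e * n) * e = e * m * (e * n * e) := by simp only [mul_assoc]
          _ = e * m * e := by rw [hen]
      · have h : φ (m * n) = 0 := by simp [hm]
        simp only [h, hm, hn, dif_pos, zero_mul, mul_zero, add_zero]
        exact h0 _ ⟨e * m, hφ.mem_notAbove (by simp [hm]), n * e, hφ.mem_notAbove (by simp [hn]),
          by simp only [mul_assoc]⟩⟩
    left_inv := fun d => by
      apply Subtype.ext
      funext m
      rcases hφ.cases m with ⟨hm, -⟩ | ⟨hm, -⟩
      · change (if h : φ m = 0 then d.1 (e * m * e) else 0) = d.1 m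
        rw [dif_neg (by simp [hm]), hone _ d.2 m hm]
      · change (if h : φ m = 0 then d.1 (e * m * e) else 0) = d.1 m
        rw [dif_pos hm, hφ.derivation_corner hφ d.2, hm, hone _ d.2 e hφ.self]
        ring
    right_inv := fun F => by
      apply Subtype.ext
      funext z
      change (if h : φ z = 0 then F.1 ⟨e * z * e, hmem h⟩ else 0) = F.1 z
      rw [dif_pos (hzero z z.2)]
      refine congrArg F.1 (Subtype.ext ?_)
      obtain ⟨⟨m, hm⟩, -⟩ := z.2
      change e * z * e = z
      rw [hm]
      simp only [mul_assoc, hφ.idem]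
      simp only [← mul_assoc, hφ.idem] }

end Equal

/-! ### Derivations for comparable ideals. -/

section Comparable

variable {φ ψ : M →* k} {e f : M} (hφ : IsIndicator φ f) (hψ : IsIndicator ψ e)
  (hef : IdemLT e f)

include hφ hef in
lemma IsIndicator.eq_zero_of_lt : φ e = 0 := by
  rcases hφ.cases e with ⟨-, h⟩ | ⟨h, -⟩
  · rw [hef.2.1, hef.1] at h
    exact absurd h hef.2.2
  · exact h

include hψ hef in
lemma IsIndicator.eq_one_of_lt : ψ f = 1 :=
  hψ.eq_one (mem_aboveSet_principalIdeal.2 ⟨e, 1, by rw [hef.1, mul_one]⟩)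

include hφ hψ hef in
-- Both characters equal `1` at `f`, so `d(f) = 2d(f)` forces `d(f) = 0`, while `d(e) = d(fe)` is
-- already a value on `fMe`. Unlike in the incomparable case, no free scalar is left.
lemma finrank_derivations_lt [Finite M] :
    Module.finrank k ((corner f e →₀ k) ⧸ relLT k e f) =
      Module.finrank k (derivations (φ : M → k) ψ) := by
  have hφe := hφ.eq_zero_of_lt hef
  have hψf := hψ.eq_one_of_lt hef
  have hdf : ∀ d ∈ derivations (φ : M → k) ψ, d f = 0 := by
    intro d hd
    have := hd f f
    rw [hφ.idem, hφ.self, hψf] at this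
    linear_combination -this
  rw [relLT, finrank_quot_span]
  refine (LinearEquiv.finrank_eq ?_).symm
  exact
  { toFun := fun d => ⟨fun z => d.1 z, mem_annihilatingFunctions_eqvGen.2
      ⟨fun z hz => hφ.eq_zero_of_nullProducts hψ d.2 hz, fun x y hxy => by
        have hd := d.2
        have hf := hdf _ hd
        rcases hxy with ⟨m, n, rfl, rfl⟩ | ⟨m, hm, n, rfl, rfl⟩ | ⟨hx, hy⟩
        · simp only [toCorner, hφ.derivation_corner hψ hd, map_mul, hφ.self, hψf, hf]
          simp only [hd _ _, map_mul, hφ.self, hψf, hf]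
          ring
        · have hm' := hφ.eq_zero hm
          simp only [toCorner, hφ.derivation_corner hψ hd, map_mul, hm', hψ.self, hf]
          simp only [hd _ _, map_mul, hm', hψ.self]
          ring
        · rw [hφ.eq_zero_of_nullProducts hψ hd hx, hφ.eq_zero_of_nullProducts hψ hd hy]⟩⟩
    map_add' := fun _ _ => rfl
    map_smul' := fun _ _ => rfl
    invFun := fun F => ⟨fun m => F.1 (toCorner f e m) - φ m * F.1 (toCorner f e 1), by
      obtain ⟨F, hF⟩ := F
      obtain ⟨h0, hr⟩ := mem_annihilatingFunctions_eqvGen.1 hF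
      have h1 : ∀ m n, F (toCorner f e (m * n)) = F (toCorner f e (m * f * n)) :=
        fun m n => hr _ _ (Or.inl ⟨m, n, rfl, rfl⟩)
      have h2 : ∀ m ∈ notAbove (principalIdeal f), ∀ n,
          F (toCorner f e (m * n)) = F (toCorner f e (m * e * n)) :=
        fun m hm n => hr _ _ (Or.inr (Or.inl ⟨m, hm, n, rfl, rfl⟩))
      have h3 : ∀ m, φ m = 1 → ∀ n, F (toCorner f e (m * n)) = F (toCorner f e n) := by
        intro m hm n
        rcases hφ.cases m with ⟨-, hfm⟩ | ⟨h, -⟩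
        · rw [h1]
          congr 1
          apply toCorner_congr
          calc f * (m * f * n) * e = (f * m * f) * n * e := by simp only [mul_assoc]
            _ = f * n * e := by rw [hfm]
        · exact absurd (hm.symm.trans h) one_ne_zero
      intro m n
      dsimp only
      rw [map_mul]
      rcases hφ.cases m with ⟨hm, -⟩ | ⟨hm, hm'⟩
      · have h4 := h3 m hm 1
        rw [mul_one] at h4
        rw [h3 m hm, h4, hm]
        ring
      · rcases hψ.cases n with ⟨hn, hen⟩ | ⟨hn, hn'⟩
        · rw [h2 m hm' n, hm, hn, toCorner_congr (m := m * e * n) (n := m)]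
          · ring
          · calc f * (m * e * n) * e = f * m * (e * n * e) := by simp only [mul_assoc]
              _ = f * m * e := by rw [hen]
        · rw [h0 (toCorner f e (m * n)) ⟨f * m, hφ.mem_notAbove (by simp [hm]), n * e,
            hψ.mem_notAbove (by simp [hn]), by simp only [toCorner, mul_assoc]⟩, hm, hn]
          ring⟩
    left_inv := fun d => by
      apply Subtype.ext
      funext m
      change d.1 (f * m * e) - φ m * d.1 (f * 1 * e) = d.1 m
      rw [hφ.derivation_corner hψ d.2, hφ.derivation_corner hψ d.2, derivation_one d.2, map_one,
        map_one, hdf _ d.2]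
      ring
    right_inv := fun F => by
      apply Subtype.ext
      funext z
      obtain ⟨m, rfl⟩ := exists_toCorner z
      change F.1 (toCorner f e (f * m * e)) - φ (f * m * e) * F.1 _ = F.1 (toCorner f e m)
      rw [toCorner_congr (m := f * m * e) (n := m)
          (by simp only [mul_assoc, hψ.idem]; simp only [← mul_assoc, hφ.idem])]
      simp [hφe] }

include hψ in
-- Since `eae = e` on `M_X`, the map is the linearised character `ψ` with values in the line spanned
-- by `e`.
lemma rhoLT_single (a : corner f e) :
    rhoLT k e f (Finsupp.single a 1) = ψ a • Finsupp.single e (1 : k) := by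
  classical
  rw [rhoLT, Finsupp.linearCombination_single, one_smul]
  by_cases h : (a : M) ∈ aboveSet (principalIdeal e)
  · rw [if_pos h, hψ.eq_one h, hψ.corner_eq h, one_smul]
  · rw [if_neg h, hψ.eq_zero h, zero_smul]

include hψ hef in
lemma relLT_le_ker_rhoLT : relLT k e f ≤ LinearMap.ker (rhoLT k e f) := by
  have hψf := hψ.eq_one_of_lt hef
  have hnull : ∀ z ∈ nullProducts f e, ψ z = 0 := by
    rintro _ ⟨m, -, n, hn, rfl⟩
    rw [map_mul, hψ.eq_zero hn, mul_zero]
  rw [relLT, Submodule.span_le]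
  rintro _ (⟨z, hz, rfl⟩ | ⟨x, y, hxy, rfl⟩)
  · rw [SetLike.mem_coe, LinearMap.mem_ker, rhoLT_single hψ, hnull z hz, zero_smul]
  · have : ψ x = ψ y := by
      induction hxy with
      | rel x y h =>
        rcases h with ⟨m, n, rfl, rfl⟩ | ⟨m, -, n, rfl, rfl⟩ | ⟨hx, hy⟩
        · simp [toCorner, hψf]
        · simp [toCorner, hψ.self]
        · rw [hnull _ hx, hnull _ hy]
      | refl x => rfl
      | symm x y _ ih => exact ih.symm
      | trans x y z _ _ ih1 ih2 => exact ih1.trans ih2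
    rw [SetLike.mem_coe, LinearMap.mem_ker, map_sub, rhoLT_single hψ, rhoLT_single hψ, this,
      sub_self]

include hφ hψ hef in
-- The map to `kG_e` has rank one, as `fe` goes to `e`. Passing to its kernel thus removes the one
-- dimension that the inner derivations account for.
lemma finrank_VLT [Finite M] :
    Module.finrank k (VLT k e f) + 1 = Module.finrank k (derivations (φ : M → k) ψ) := by
  rw [← finrank_derivations_lt hφ hψ hef, VLT_eq_ker k e f (relLT_le_ker_rhoLT hψ hef),
    ← ((relLT k e f).liftQ (rhoLT k e f)
      (relLT_le_ker_rhoLT hψ hef)).finrank_range_add_finrank_ker, Submodule.range_liftQ,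
    add_comm]
  congr 1
  have hrange : LinearMap.range (rhoLT k e f) = Submodule.span k {Finsupp.single e (1 : k)} := by
    apply le_antisymm
    · rintro _ ⟨x, rfl⟩
      induction x using Finsupp.induction_linear with
      | zero => simp
      | add x y hx hy => rw [map_add]; exact add_mem hx hy
      | single a c =>
        rw [← mul_one c, ← smul_eq_mul, ← Finsupp.smul_single, map_smul, rhoLT_single hψ]
        exact Submodule.smul_mem _ _ (Submodule.smul_mem _ _ (Submodule.mem_span_singleton_self _))
    · rw [Submodule.span_singleton_le_iff_mem]
      refine ⟨Finsupp.single (toCorner f e 1) 1, ?_⟩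
      rw [rhoLT_single hψ]
      simp [toCorner, hψ.self, hψ.eq_one_of_lt hef]
  rw [hrange, finrank_span_singleton (by simp)]

end Comparable

/-! ### Passage to the opposite monoid. -/

section Opposite

open MulOpposite

/-- A homomorphism to a field as a homomorphism from the opposite monoid. -/
def opHom (φ : M →* k) : Mᵐᵒᵖ →* k where
  toFun m := φ m.unop
  map_one' := map_one φ
  map_mul' a b := by rw [unop_mul, map_mul, mul_comm]

lemma mem_aboveSet_op {e : M} {m : Mᵐᵒᵖ} :
    m ∈ aboveSet (principalIdeal (op e)) ↔ m.unop ∈ aboveSet (principalIdeal e) := by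
  rw [mem_aboveSet_principalIdeal, mem_aboveSet_principalIdeal]
  constructor
  · rintro ⟨a, b, h⟩
    refine ⟨b.unop, a.unop, ?_⟩
    rw [← unop_op e, h, unop_mul, unop_mul, mul_assoc]
  · rintro ⟨a, b, h⟩
    refine ⟨op b, op a, unop_injective ?_⟩
    simp only [unop_op, unop_mul, ← mul_assoc, h]

lemma IsIndicator.op {φ : M →* k} {e : M} (h : IsIndicator φ e) :
    IsIndicator (opHom φ) (op e) where
  idem := by rw [← op_mul, h.idem]
  eq_one hm := h.eq_one (mem_aboveSet_op.1 hm)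
  eq_zero hm := h.eq_zero fun hm' => hm (mem_aboveSet_op.2 hm')
  corner_eq hm := unop_injective <| by
    rw [unop_mul, unop_mul, unop_op, ← mul_assoc, h.corner_eq (mem_aboveSet_op.1 hm)]

lemma IdemLT.op {e f : M} (h : IdemLT e f) : IdemLT (op e) (op f) :=
  ⟨by rw [← op_mul, h.2.1], by rw [← op_mul, h.1], fun h' => h.2.2 (op_injective h')⟩

/-- Derivations of a monoid and of its opposite agree. -/
def derivationsOpEquiv (φ ψ : M →* k) :
    derivations (φ : M → k) ψ ≃ₗ[k] derivations (opHom ψ : Mᵐᵒᵖ → k) (opHom φ) where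
  toFun d := ⟨fun m => d.1 m.unop, fun m n => by
    dsimp only
    rw [unop_mul, d.2]
    change φ n.unop * _ + _ * ψ m.unop = ψ m.unop * _ + _ * φ n.unop
    ring⟩
  invFun d := ⟨fun m => d.1 (op m), fun m n => by
    dsimp only
    rw [op_mul, d.2]
    change ψ n * _ + _ * φ m = φ m * _ + _ * ψ n
    ring⟩
  map_add' _ _ := rfl
  map_smul' _ _ := rfl
  left_inv _ := rfl
  right_inv _ := rfl

/-- Reversing products exchanges `φ` and `ψ` in the Leibniz rule, which turns the case `f < e` into
the preceding one. -/
lemma finrank_VGT [Finite M] {φ ψ : M →* k} {e f : M} (hφ : IsIndicator φ f)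
    (hψ : IsIndicator ψ e) (hfe : IdemLT f e) :
    Module.finrank k (VGT k e f) + 1 = Module.finrank k (derivations (φ : M → k) ψ) := by
  have : Finite Mᵐᵒᵖ := Finite.of_equiv M opEquiv
  rw [(derivationsOpEquiv φ ψ).finrank_eq]
  exact finrank_VLT hψ.op hφ.op hfe.op

end Opposite

end Comparison

/-! ### Characters of primary ideals and the dimension of their inner derivations. -/

section Arrows

universe u v

variable {M : Type u} [Monoid M] [Finite M] (k : Type v) [Field k]

lemma isIndicator_supportChar (hrect : IsRectangular M) (htriv : HasTrivialMaximalSubgroups M)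
    {X : SupportLattice M} {e : M} (he : IsIdempotentElem e) (hX : principalIdeal e = X.1) :
    IsIndicator (supportChar k X) e where
  idem := he
  eq_one hm := if_pos (hX ▸ hm)
  eq_zero hm := if_neg (hX ▸ hm)
  corner_eq hm := idem_mul_mul_idem hrect htriv he hm

omit [Finite M] in
lemma finrank_innerDerivations_of_ne {φ ψ : M →* k} {m : M} (h : φ m ≠ ψ m) :
    Module.finrank k (innerDerivations (φ : M → k) ψ) = 1 :=
  finrank_span_singleton fun h' => h (sub_eq_zero.1 (congrFun h' m))

omit [Finite M] in
lemma finrank_innerDerivations_self (φ : M →* k) :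
    Module.finrank k (innerDerivations (φ : M → k) φ) = 0 := by
  rw [innerDerivations, sub_self, Submodule.span_zero_singleton, finrank_bot]

end Arrows

end RectMonoid

theorem mainTheorem12 (M : Type*) [Monoid M] [Finite M] (k : Type*) [Field k]
    (hrect : RectMonoid.IsRectangular M) (htriv : RectMonoid.HasTrivialMaximalSubgroups M) :
    -- `kM` splits over `k`, so that its quiver is defined
    RectMonoid.IsSplit k (MonoidAlgebra k M) ∧
    -- the vertex set of the quiver is `Λ(M)`
    Function.Bijective (fun X : RectMonoid.SupportLattice M => RectMonoid.supportVertex k X) ∧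
    -- idempotent generators as used below can be chosen
    (∀ X : RectMonoid.SupportLattice M, ∃ e : M,
      IsIdempotentElem e ∧ RectMonoid.principalIdeal e = X.1) ∧
    (∀ X Y : RectMonoid.SupportLattice M, X < Y → ∀ f : M, IsIdempotentElem f →
      RectMonoid.principalIdeal f = Y.1 → ∃ e : M,
        IsIdempotentElem e ∧ RectMonoid.principalIdeal e = X.1 ∧ RectMonoid.IdemLT e f) ∧
    -- the number of arrows from `X` to `Y` is `dim V_{X,Y}`
    (∀ (X Y : RectMonoid.SupportLattice M) (e f : M),
      IsIdempotentElem e → RectMonoid.principalIdeal e = X.1 →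
      IsIdempotentElem f → RectMonoid.principalIdeal f = Y.1 →
      (¬ X ≤ Y → ¬ Y ≤ X →
        RectMonoid.numArrows k (MonoidAlgebra k M)
          (RectMonoid.supportVertex k X) (RectMonoid.supportVertex k Y) =
            (Module.finrank k (RectMonoid.VIncomparable k e f) : Cardinal)) ∧
      (X = Y → e = f →
        RectMonoid.numArrows k (MonoidAlgebra k M)
          (RectMonoid.supportVertex k X) (RectMonoid.supportVertex k Y) =
            (Module.finrank k (RectMonoid.VEq k e) : Cardinal)) ∧
      (X < Y → RectMonoid.IdemLT e f →
        RectMonoid.numArrows k (MonoidAlgebra k M)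
          (RectMonoid.supportVertex k X) (RectMonoid.supportVertex k Y) =
            (Module.finrank k (RectMonoid.VLT k e f) : Cardinal)) ∧
      (Y < X → RectMonoid.IdemLT f e →
        RectMonoid.numArrows k (MonoidAlgebra k M)
          (RectMonoid.supportVertex k X) (RectMonoid.supportVertex k Y) =
            (Module.finrank k (RectMonoid.VGT k e f) : Cardinal))) := by

  refine ⟨RectMonoid.isSplit_monoidAlgebra k hrect htriv,
    RectMonoid.supportVertex_bijective k hrect htriv,
    fun X => RectMonoid.exists_idem_generator X.2, ?_, ?_⟩
  · intro X Y hXY f hf hfY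
    obtain ⟨e, he, heX⟩ := RectMonoid.exists_idem_generator X.2
    rw [← heX]
    refine RectMonoid.exists_idem_lt he hf ?_
    rw [heX, hfY]
    exact hXY
  · intro X Y e f he heX hf hfY
    have hψ := RectMonoid.isIndicator_supportChar k hrect htriv he heX
    have hφ := RectMonoid.isIndicator_supportChar k hrect htriv hf hfY
    have hφe : ¬ Y ≤ X → RectMonoid.supportChar k Y e = 0 := fun h =>
      hφ.eq_zero fun h' => h (by rw [← Subtype.coe_le_coe, ← hfY, ← heX]; exact h')
    have hψf : ¬ X ≤ Y → RectMonoid.supportChar k X f = 0 := fun h =>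
      hψ.eq_zero fun h' => h (by rw [← Subtype.coe_le_coe, ← hfY, ← heX]; exact h')
    refine ⟨fun hXY hYX => ?_, ?_, fun hXY hef => ?_, fun hYX hfe => ?_⟩
    · apply RectMonoid.numArrows_eq
      -- `e` separates the two characters unless `Y ≤ X`; when `Y < X` the idempotent `f` does so
      -- instead.
      rw [RectMonoid.finrank_innerDerivations_of_ne k (m := e)
        (by rw [hφe hYX, hψ.self]; exact zero_ne_one)]
      exact RectMonoid.finrank_derivations_incomparable hφ hψ (hφe hYX) (hψf hXY)
    · rintro rfl rfl
      apply RectMonoid.numArrows_eq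
      rw [RectMonoid.finrank_innerDerivations_self, add_zero]
      exact RectMonoid.finrank_derivations_eq hψ (htriv e he)
    · apply RectMonoid.numArrows_eq
      rw [RectMonoid.finrank_innerDerivations_of_ne k (m := e)
        (by rw [hφe hXY.not_ge, hψ.self]; exact zero_ne_one)]
      exact RectMonoid.finrank_VLT hφ hψ hef
    · apply RectMonoid.numArrows_eq
      rw [RectMonoid.finrank_innerDerivations_of_ne k (m := f)
        (by rw [hψf hYX.not_ge, hφ.self]; exact one_ne_zero)]
      exact RectMonoid.finrank_VGT hφ hψ hfe
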